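/- Let $T\in(0,\infty)$, let $(\Omega,\mathcal F,\mathbb P)$ be a probability space with a normal filtration $(\mathcal F_t)_{t\in[0,T]}$ (right-continuous, with $\mathcal F_0$ containing all events of probability zero), and let $W=(W(t))_{t\in[0,T]}$ be a standard one-dimensional $(\mathcal F_t)$-Brownian motion. Let $0<\tau_1<\tau_2<T$ and let $f,g,h\in C^\infty(\mathbb R)$ be bounded with $f=0$ outside $(-\infty,\tau_1]$, $\inf_{t\in[0,\tau_1/2]}|f'(t)|>0$, $g=0$ outside $[\tau_1,\tau_2]$, $g\neq 0$, $h=0$ outside $[\tau_2,\infty)$ and $\int_{\tau_2}^T h(t)\,dt\neq 0$. For $\psi\in C^\infty(\mathbb R)$ let $X^\psi=(X^\psi(t))_{t\in[0,T]}$ be the strong solution of the four-dimensional SDE $$dX^\psi(t)=\mu^\psi(X^\psi(t))\,dt+\sigma(X^\psi(t))\,dW(t),\quad t\in[0,T],\qquad X^\psi(0)=0,$$ where $\mu^\psi(x)=(1,0,0,h(x_1)\cos(x_2\psi(x_3)))$ and $\sigma(x)=(0,f(x_1),g(x_1),0)$. Put $$\alpha=\inf_{t\in[0,\tau_1/2]}|f'(t)|^2,\quad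 \beta=\int_{\tau_1}^{\tau_2}g(t)^2\,dt,\quad \gamma=\int_{\tau_2}^T h(t)\,dt,\quad c_1=\frac{|\gamma|\exp(-\frac{\pi^2}{4}-\frac1\beta)}{8\pi\sqrt{2\pi\beta}},\quad c_2=\frac{|\gamma|\exp(-\frac{\pi^2}{4})}{4\pi}.$$ Let $\delta\in(0,T]$. An adaptive approximation is given by measurable maps $\varphi_n:\mathbb R^{n-1}\times\mathbb R^{[\delta,T]}\to(0,\delta)$, $\chi_n:\mathbb R^n\times\mathbb R^{[\delta,T]}\to\{0,1\}$ and $\phi_n:\mathbb R^n\times\mathbb R^{[\delta,T]}\to\mathbb R^4$, $n\geq 1$, where $\mathbb R^{[\delta,T]}$ carries the product $\sigma$-algebra, as follows: put $V=(W(t))_{t\in[\delta,T]}$, $Y_n=W(\varphi_n(Y_1,\dots,Y_{n-1},V))$, $D_n=(Y_1,\dots,Y_n,V)$ and $\nu=\min\{n\geq 1:\chi_n(D_n)=1\}$, require $\nu<\infty$ almost surely, and set $\widehat X=\phi_\nu(D_\nu)$. For an integer $N\geq 1$ let $\mathcal X^\delta_N$ be the class of all such $\widehat X$ with $\mathbb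 E\,\nu\leq N$. **Theorem.** Let $\delta\in(0,T]$ and let $\psi\in C^\infty(\mathbb R)$ be positive and strictly increasing with $\lim_{x\to\infty}\psi(x)=\infty$ and $1\in\psi(\mathbb R)$. Then for all integers $N\geq 1$ and all $\widehat X\in\mathcal X^\delta_N$, $$\mathbb E\,\|X^\psi(T)-\widehat X\|\;\geq\; c_1\cdot\exp\Bigl(-\tfrac1\beta\Bigl(\psi^{-1}\Bigl(\Bigl(1+\sqrt{\tfrac{96}{\alpha\,(\min(\delta,\tau_1/2))^3}}\Bigr)N^3\Bigr)\Bigr)^2\Bigr)-\frac{c_2}{N},$$ where $\|\cdot\|$ is the Euclidean norm on $\mathbb R^4$ and the expectation may be $+\infty$. -/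

import Mathlib

open MeasureTheory ProbabilityTheory Filter Set
open scoped Topology ENNReal

noncomputable section

/-- Four-dimensional real space with the Euclidean norm. -/
abbrev E4 := EuclideanSpace ℝ (Fin 4)

/-! ### Brownian motion and stochastic integral on `[0, T]`

Processes and filtrations are indexed by `ℝ`; only times in `[0, T]` enter the definitions.
Every filtration on `[0, T]` is the restriction of such a filtration. -/

section Stochastic

variable {Ω : Type*} {mΩ : MeasurableSpace Ω}

/-- The filtration `(𝓕 t)`, `t ∈ [0, T]`, is normal: it is right-continuous and `𝓕 0` contains all
events of probability zero. -/
structure IsNormalFiltration (T : ℝ) (𝓕 : Filtration ℝ mΩ) (P : Measure Ω) : Prop where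
  rightCont : ∀ t ∈ Ico (0 : ℝ) T, (⨅ s ∈ Ioc t T, 𝓕 s) ≤ 𝓕 t
  null : ∀ A : Set Ω, MeasurableSet A → P A = 0 → MeasurableSet[𝓕 0] A

/-- `W` is a standard one-dimensional Brownian motion on `[0, T]` with respect to the
filtration `𝓕`. -/
structure IsBrownianMotionOn (T : ℝ) (𝓕 : Filtration ℝ mΩ) (W : ℝ → Ω → ℝ) (P : Measure Ω) :
    Prop where
  adapted : ∀ t ∈ Icc (0 : ℝ) T, Measurable[𝓕 t] (W t)
  zero : ∀ᵐ ω ∂P, W 0 ω = 0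
  law : ∀ s t, 0 ≤ s → s ≤ t → t ≤ T →
    P.map (fun ω => W t ω - W s ω) = gaussianReal 0 (Real.toNNReal (t - s))
  indep : ∀ s t, 0 ≤ s → s ≤ t → t ≤ T →
    Indep (MeasurableSpace.comap (fun ω => W t ω - W s ω) inferInstance) (𝓕 s) P
  cont : ∀ᵐ ω ∂P, ContinuousOn (fun t => W t ω) (Icc 0 T)

/-- Simple integrands on `[0, T]`: finite sums of `ξ i` times the indicator of
`(t i, t (i + 1)]`, with `ξ i` bounded and `𝓕 (t i)`-measurable. -/
structure SimpleIntegrand (T : ℝ) (𝓕 : Filtration ℝ mΩ) where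
  /-- number of intervals -/
  n : ℕ
  /-- end points of the intervals (those with index at most `n` matter) -/
  t : ℕ → ℝ
  /-- values on the intervals (those with index less than `n` matter) -/
  ξ : ℕ → Ω → ℝ
  mono : Monotone t
  mem : ∀ i, t i ∈ Icc (0 : ℝ) T
  meas : ∀ i, Measurable[𝓕 (t i)] (ξ i)
  bdd : ∃ C : ℝ, ∀ i ω, |ξ i ω| ≤ C

/-- The value at time `s` of a simple integrand. -/
def SimpleIntegrand.val {T : ℝ} {𝓕 : Filtration ℝ mΩ} (Z : SimpleIntegrand T 𝓕)
    (s : ℝ) (ω : Ω) : ℝ :=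
  ∑ i ∈ Finset.range Z.n, (Ioc (Z.t i) (Z.t (i + 1))).indicator (fun _ => Z.ξ i ω) s

/-- The elementary stochastic integral over `[0, u]` of a simple integrand. -/
def SimpleIntegrand.integral {T : ℝ} {𝓕 : Filtration ℝ mΩ} (Z : SimpleIntegrand T 𝓕)
    (W : ℝ → Ω → ℝ) (u : ℝ) (ω : Ω) : ℝ :=
  ∑ i ∈ Finset.range Z.n, Z.ξ i ω * (W (min (Z.t (i + 1)) u) ω - W (min (Z.t i) u) ω)

/-- `I` is (a version of) the Itô integral `∫₀ᵘ H(s) dW(s)` of the square-integrable integrand `H`: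
it is the limit in `L²(P)` of the elementary integrals of simple integrands
that converge to `H` in `L²([0, u] × Ω)`. -/
def IsItoIntegral (T : ℝ) (𝓕 : Filtration ℝ mΩ) (P : Measure Ω) (W : ℝ → Ω → ℝ)
    (u : ℝ) (H : ℝ → Ω → ℝ) (I : Ω → ℝ) : Prop :=
  ∃ Z : ℕ → SimpleIntegrand T 𝓕,
    Tendsto (fun k => ∫⁻ ω, (∫⁻ s in Icc (0 : ℝ) u, ‖(Z k).val s ω - H s ω‖ₑ ^ 2) ∂P)
      atTop (𝓝 0) ∧
    Tendsto (fun k => ∫⁻ ω, ‖(Z k).integral W u ω - I ω‖ₑ ^ 2 ∂P) atTop (𝓝 0)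

/-- `X` is a (strong) solution on `[0, T]` of the autonomous equation
`dX(t) = μ(X(t)) dt + σ(X(t)) dW(t)`, `X(0) = x₀`, with a scalar Brownian motion `W`: an adapted
process with continuous paths which satisfies, componentwise and for every `u ∈ [0, T]`,
`X(u) = x₀ + ∫₀ᵘ μ(X(s)) ds + ∫₀ᵘ σ(X(s)) dW(s)` almost surely.
(For bounded continuous `μ`, `σ` all integrals are defined in the sense used here.) -/
structure IsSDESolution {d : ℕ} (T : ℝ) (𝓕 : Filtration ℝ mΩ) (P : Measure Ω) (W : ℝ → Ω → ℝ)
    (μ σ : EuclideanSpace ℝ (Fin d) → EuclideanSpace ℝ (Fin d)) (x₀ : EuclideanSpace ℝ (Fin d))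
    (X : ℝ → Ω → EuclideanSpace ℝ (Fin d)) : Prop where
  adapted : ∀ t ∈ Icc (0 : ℝ) T, Measurable[𝓕 t] (X t)
  cont : ∀ᵐ ω ∂P, ContinuousOn (fun t => X t ω) (Icc 0 T)
  init : ∀ᵐ ω ∂P, X 0 ω = x₀
  eqn : ∀ u ∈ Icc (0 : ℝ) T, ∀ i : Fin d,
    IsItoIntegral T 𝓕 P W u (fun s ω => σ (X s ω) i)
      (fun ω => X u ω i - x₀ i - ∫ s in (0 : ℝ)..u, μ (X s ω) i)

end Stochastic

/-! ### The family of equations -/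

/-- Drift coefficient `(1, 0, 0, h(x₁) cos(x₂ ψ(x₃)))`. -/
def driftCoeff (h ψ : ℝ → ℝ) (x : E4) : E4 :=
  !₂[1, 0, 0, h (x 0) * Real.cos (x 1 * ψ (x 2))]

/-- Diffusion coefficient `(0, f(x₁), g(x₁), 0)`. -/
def diffusionCoeff (f g : ℝ → ℝ) (x : E4) : E4 :=
  !₂[0, f (x 0), g (x 0), 0]

/-- `0 < τ₁ < τ₂ < T`, and `f`, `g`, `h` are smooth and bounded with
`f = 0` outside `(-∞, τ₁]`, `inf |f'| > 0` on `[0, τ₁ / 2]`, `0 ≠ g = 0` outside `[τ₁, τ₂]`,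
`h = 0` outside `[τ₂, ∞)` and nonzero integral of `h` over `[τ₂, T]`. -/
structure IsSetting (T τ₁ τ₂ : ℝ) (f g h : ℝ → ℝ) : Prop where
  τ₁_pos : 0 < τ₁
  τ₁_lt : τ₁ < τ₂
  τ₂_lt : τ₂ < T
  f_smooth : ContDiff ℝ (⊤ : ℕ∞) f
  g_smooth : ContDiff ℝ (⊤ : ℕ∞) g
  h_smooth : ContDiff ℝ (⊤ : ℕ∞) h
  f_bdd : ∃ C, ∀ x, |f x| ≤ C
  g_bdd : ∃ C, ∀ x, |g x| ≤ C
  h_bdd : ∃ C, ∀ x, |h x| ≤ C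
  f_supp : Function.support f ⊆ Iic τ₁
  f_deriv : 0 < ⨅ t : Icc (0 : ℝ) (τ₁ / 2), |deriv f t|
  g_supp : Function.support g ⊆ Icc τ₁ τ₂
  g_ne : g ≠ 0
  h_supp : Function.support h ⊆ Ici τ₂
  h_int : (∫ t in τ₂..T, h t) ≠ 0

/-- `α`, the infimum of `|f'|²` over `[0, τ₁ / 2]`. -/
def alphaConst (τ₁ : ℝ) (f : ℝ → ℝ) : ℝ := ⨅ t : Icc (0 : ℝ) (τ₁ / 2), |deriv f t| ^ 2

/-- `β`, the integral of `g²` over `[τ₁, τ₂]`. -/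
def betaConst (τ₁ τ₂ : ℝ) (g : ℝ → ℝ) : ℝ := ∫ t in τ₁..τ₂, g t ^ 2

/-- `γ`, the integral of `h` over `[τ₂, T]`. -/
def gammaConst (τ₂ T : ℝ) (h : ℝ → ℝ) : ℝ := ∫ t in τ₂..T, h t

/-- The constant `c₁` as a function of `β` and `γ`. -/
def c₁Const (β γ : ℝ) : ℝ :=
  |γ| * Real.exp (-(Real.pi ^ 2 / 4) - 1 / β) / (8 * Real.pi * √(2 * Real.pi * β))

/-- The constant `c₂` as a function of `γ`. -/
def c₂Const (γ : ℝ) : ℝ := |γ| * Real.exp (-(Real.pi ^ 2 / 4)) / (4 * Real.pi)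

/-! ### Adaptive approximations -/

/-- An adaptive method that knows the path on `[δ, T]` and evaluates it sequentially in `(0, δ)`.
After `n` evaluations the data are the observed values `y ∈ ℝⁿ` and the path `v ∈ ℝ^[δ, T]`
(with the product σ-algebra); `site n` gives the next evaluation site, `halt n` and `estimate n`
are the stopping rule and the output after `n + 1` evaluations. -/
structure AdaptiveMethod (δ T : ℝ) where
  /-- evaluation site number `n + 1` -/
  site : (n : ℕ) → (Fin n → ℝ) × (Icc δ T → ℝ) → ℝ
  /-- stopping rule after `n + 1` evaluations -/
  halt : (n : ℕ) → (Fin (n + 1) → ℝ) × (Icc δ T → ℝ) → Bool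
  /-- output after `n + 1` evaluations -/
  estimate : (n : ℕ) → (Fin (n + 1) → ℝ) × (Icc δ T → ℝ) → E4
  site_mem : ∀ n d, site n d ∈ Ioo 0 δ
  site_meas : ∀ n, Measurable (site n)
  halt_meas : ∀ n, Measurable (halt n)
  estimate_meas : ∀ n, Measurable (estimate n)

namespace AdaptiveMethod

variable {δ T : ℝ} (M : AdaptiveMethod δ T)

/-- The first `n` observed values for the path `w`. -/
def obs (w : ℝ → ℝ) : (n : ℕ) → Fin n → ℝ
  | 0 => Fin.elim0
  | n + 1 => Fin.snoc (obs w n) (w (M.site n (obs w n, fun t => w t)))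

/-- The data `(y₁, …, yₙ, v)` available after `n` evaluations of the path `w`. -/
def data (w : ℝ → ℝ) (n : ℕ) : (Fin n → ℝ) × (Icc δ T → ℝ) :=
  (M.obs w n, fun t => w t)

/-- The method stops for the path `w`, after some finite number of evaluations. -/
abbrev Stops (w : ℝ → ℝ) : Prop := ∃ n, M.halt n (M.data w (n + 1)) = true

open Classical in
/-- The number `ν ∈ {1, 2, …, ∞}` of evaluations of the path `w` in `(0, δ)`. -/
def numEval (w : ℝ → ℝ) : ℕ∞ :=
  if h : M.Stops w then ((Nat.find h + 1 : ℕ) : ℕ∞) else ⊤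

open Classical in
/-- The output of the method for the path `w` (zero if the method does not stop). -/
def output (w : ℝ → ℝ) : E4 :=
  if h : M.Stops w then M.estimate (Nat.find h) (M.data w (Nat.find h + 1)) else 0

/-- The expected number of evaluations when the method is applied to the paths of `W`. -/
def cost {Ω : Type*} {mΩ : MeasurableSpace Ω} (P : Measure Ω) (W : ℝ → Ω → ℝ) : ℝ≥0∞ :=
  ∫⁻ ω, (M.numEval (fun t => W t ω) : ℝ≥0∞) ∂P

end AdaptiveMethod

end

/-! ### One-dimensional Gaussian estimates -/

/-! At time `T` the last component is γ cos(ψ(I₂) I₁), where I₁ and I₂ are the Wiener integrals of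
`f` and `g` (`IsSDESolution.ae_final`). Integration by parts turns them into the path integrals -∫
f' W and -∫ g' W. Put D = min(δ, τ₁/2). Changing the path inside (0, D) leaves I₂ alone but moves
I₁, and there a method sees only finitely many values. When I₂ is large, the factor ψ(I₂) magnifies
what is still unknown about I₁ until the cosine cannot be predicted.

Quantitatively, cut [0, D] into 2N² intervals of length d. By Markov's inequality the method uses at
most N² evaluations outside an event of probability 1/N, and then at least N² intervals contain no
site. The midpoint displacements of the path on these intervals are independent Gaussians of
variance d/4, independent of the rest of the path (`IsContinuousBrownian.indep_removeDisp`). They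
enter I₁ through a Gaussian Q of variance at least α D³ / (128 N⁴). The threshold K for ψ(I₂) is
such that K² Var Q ≥ 3/4. Given the rest of the path, any guess of the cosine then has mean error at
least 9/196 (`lintegral_abs_cos_sub_ge_of_indep`). The event ψ(I₂) ≥ K is a Gaussian tail, bounded
below by `gaussianReal_Ici_ge`.

Adaptivity makes the set of hit intervals random. The sample space is therefore split according to
the stopping index and the set S of hit intervals. On each piece, removing the displacements outside
S does not alter the run of the method. Hence both the piece and the output are measurable with
respect to the modified path, which is independent of Q (`AdaptiveMethod.lintegral_error_ge`). -/

lemma integral_cos_gaussianReal (v : NNReal) (θ c : ℝ) :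
    ∫ q, Real.cos (θ + c * q) ∂gaussianReal 0 v
      = Real.cos θ * Real.exp (-(c ^ 2 * v / 2)) := by
  have h1 := charFun_gaussianReal (μ := 0) (v := v) c
  rw [charFun_apply_real] at h1
  have hint : Integrable (fun q : ℝ => Complex.exp ((c * q : ℝ) * Complex.I)) (gaussianReal 0 v) := by
    refine Integrable.of_bound (C := 1) (by fun_prop) (ae_of_all _ fun q => ?_)
    rw [Complex.norm_exp_ofReal_mul_I]
  have h2 : ∫ q, Complex.exp ((c * q : ℝ) * Complex.I) ∂gaussianReal 0 v
      = ((Real.exp (-(c ^ 2 * v / 2)) : ℝ) : ℂ) := by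
    have e : ∀ q : ℝ, (((c * q : ℝ) : ℂ) * Complex.I) = (c : ℂ) * q * Complex.I := by
      intro q; push_cast; ring
    simp_rw [e]
    rw [h1]
    push_cast
    congr 1
    ring
  have h3 : ∀ q : ℝ, Real.cos (θ + c * q)
      = RCLike.re (Complex.exp (θ * Complex.I) * Complex.exp ((c * q : ℝ) * Complex.I)) := by
    intro q
    rw [← Complex.exp_add, ← add_mul, ← Complex.ofReal_add]
    exact (Complex.exp_ofReal_mul_I_re _).symm
  simp_rw [h3]
  rw [integral_re (hint.const_mul _), integral_const_mul, h2]
  change (_ * _ : ℂ).re = _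
  rw [Complex.re_mul_ofReal, Complex.exp_ofReal_mul_I_re]

/-- Half the variance bounds the mean absolute error from below. For Y = cos(θ + c q) with mean e,
the variance equals E (Y - a)(Y - e) for every a, and |Y - e| ≤ 2. With p = exp(-c² v) the variance
is (1 - p)/2 - cos(2θ) p (1 - p)/2, which is at least (1 - p)²/2 for every phase θ. -/
lemma integral_abs_cos_sub_gaussianReal_ge (v : NNReal) (θ c a : ℝ) :
    (1 - Real.exp (-(c ^ 2 * v))) ^ 2 / 4 ≤ ∫ q, |Real.cos (θ + c * q) - a| ∂gaussianReal 0 v := by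
  set μ := gaussianReal 0 v
  set Y : ℝ → ℝ := fun q => Real.cos (θ + c * q)
  have hYc : Continuous Y := by fun_prop
  have hY : Integrable Y μ := Integrable.of_bound (C := 1) hYc.aestronglyMeasurable
    (ae_of_all _ fun q => Real.abs_cos_le_one _)
  have hY2 : Integrable (fun q => Y q ^ 2) μ := by
    refine Integrable.of_bound (C := 1) (by fun_prop) (ae_of_all _ fun q => ?_)
    rw [norm_pow]
    exact pow_le_one₀ (norm_nonneg _) (Real.abs_cos_le_one _)
  set e := ∫ q, Y q ∂μ with he
  have he' : e = Real.cos θ * Real.exp (-(c ^ 2 * v / 2)) := integral_cos_gaussianReal v θ c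
  have he1 : |e| ≤ 1 := by
    have := norm_integral_le_of_norm_le_const (μ := μ) (f := Y) (C := 1)
      (ae_of_all _ fun q => Real.abs_cos_le_one _)
    simpa [measureReal_def] using this
  have hsq : ∫ q, Y q ^ 2 ∂μ = 1 / 2 + Real.cos (2 * θ) * Real.exp (-((2 * c) ^ 2 * v / 2)) / 2 := by
    have h1 : ∀ q, Y q ^ 2 = 1 / 2 + Real.cos (2 * θ + 2 * c * q) / 2 := by
      intro q
      simp only [Y]
      rw [Real.cos_sq]
      ring_nf
    simp_rw [h1]
    rw [integral_add (integrable_const _) (Integrable.div_const (Integrable.of_bound (C := 1)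
      (by fun_prop) (ae_of_all _ fun q => Real.abs_cos_le_one _)) _),
      integral_div (f := fun q => Real.cos (2 * θ + 2 * c * q)), integral_cos_gaussianReal]
    simp
  have hvar : ∫ q, (Y q - a) * (Y q - e) ∂μ = ∫ q, Y q ^ 2 ∂μ - e ^ 2 := by
    have h1 : ∀ q, (Y q - a) * (Y q - e) = Y q ^ 2 - (a + e) * Y q + a * e := by intro q; ring
    simp_rw [h1]
    rw [integral_add (f := fun q => Y q ^ 2 - (a + e) * Y q) (g := fun _ => a * e)
      (hY2.sub (hY.const_mul _)) (integrable_const _), integral_sub hY2 (hY.const_mul _),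
      integral_const_mul, ← he]
    simp
    ring
  have hle : ∫ q, (Y q - a) * (Y q - e) ∂μ ≤ ∫ q, 2 * |Y q - a| ∂μ := by
    have hYa : Integrable (fun q => Y q - a) μ := hY.sub (integrable_const _)
    refine integral_mono ?_ (hYa.abs.const_mul 2) fun q => ?_
    · refine hYa.mul_bdd (c := 2) (by fun_prop) (ae_of_all _ fun q => ?_)
      calc ‖Y q - e‖ ≤ |Y q| + |e| := abs_sub _ _
        _ ≤ 2 := by linarith [Real.abs_cos_le_one (θ + c * q)]
    · calc (Y q - a) * (Y q - e) ≤ |(Y q - a) * (Y q - e)| := le_abs_self _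
        _ = |Y q - e| * |Y q - a| := by rw [abs_mul, mul_comm]
        _ ≤ 2 * |Y q - a| := by
          gcongr
          exact (abs_sub _ _).trans (by linarith [Real.abs_cos_le_one (θ + c * q)])
  rw [integral_const_mul, hvar, hsq, he'] at hle
  set p := Real.exp (-(c ^ 2 * v)) with hp
  have hp1 : p ≤ 1 := Real.exp_le_one_iff.2 (by simp; positivity)
  have e1 : Real.exp (-(c ^ 2 * v / 2)) ^ 2 = p := by
    rw [hp, ← Real.exp_nat_mul]; congr 1; push_cast; ring
  have e2 : Real.exp (-((2 * c) ^ 2 * v / 2)) = p ^ 2 := by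
    rw [hp, ← Real.exp_nat_mul]; congr 1; push_cast; ring
  rw [mul_pow (Real.cos θ), e1, e2, Real.cos_sq] at hle
  have h0 : 0 ≤ p := (Real.exp_pos _).le
  have hC : Real.cos (2 * θ) * (p * (1 - p)) ≤ 1 * (p * (1 - p)) := by
    have := Real.cos_le_one (2 * θ)
    have : 0 ≤ 1 - p := by linarith
    gcongr
  change (1 - p) ^ 2 / 4 ≤ ∫ q, |Y q - a| ∂μ
  nlinarith

/-- Only the mass of the unit interval [x, x + 1] is kept; there y² ≤ 2x² + 2, whatever the sign of
x. -/
lemma gaussianReal_Ici_ge (v : NNReal) (hv : v ≠ 0) (x : ℝ) :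
    ENNReal.ofReal (Real.exp (-(1 / v) - 1 / v * x ^ 2) / √(2 * Real.pi * v))
      ≤ gaussianReal 0 v (Ici x) := by
  have hv' : (0 : ℝ) < v := by positivity
  rw [gaussianReal_apply_eq_integral 0 hv]
  refine ENNReal.ofReal_le_ofReal ?_
  have h1 : ∫ y in Icc x (x + 1), gaussianPDFReal 0 v y ≤ ∫ y in Ici x, gaussianPDFReal 0 v y :=
    setIntegral_mono_set (integrable_gaussianPDFReal 0 v).integrableOn
      (ae_of_all _ fun y => gaussianPDFReal_nonneg 0 v y) Icc_subset_Ici_self.eventuallyLE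
  refine le_trans ?_ h1
  have h2 : ∫ y in Icc x (x + 1), Real.exp (-(1 / v) - 1 / v * x ^ 2) / √(2 * Real.pi * v)
      ≤ ∫ y in Icc x (x + 1), gaussianPDFReal 0 v y := by
    refine setIntegral_mono_on (by simp) (integrable_gaussianPDFReal 0 v).integrableOn
      measurableSet_Icc fun y hy => ?_
    rw [gaussianPDFReal, div_eq_inv_mul]
    gcongr
    rw [neg_sub_left, neg_div, neg_le_neg_iff, div_le_iff₀ (by positivity)]
    have : (1 / (v : ℝ) * x ^ 2 + 1 / v) * (2 * v) = 2 * x ^ 2 + 2 := by field_simp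
    rw [this]
    obtain ⟨h3, h4⟩ := hy
    nlinarith [sq_nonneg (x - 1), sq_nonneg (y - x), sq_nonneg (2 * x - y)]
  refine le_trans (le_of_eq ?_) h2
  simp

/-- A lower bound for the mean error when `cos (c (m + Q))` is estimated from data independent
of the Gaussian variable `Q`. -/
lemma lintegral_abs_cos_sub_ge_of_indep {Ω : Type*} {m₀ mΩ : MeasurableSpace Ω} (P : Measure Ω)
    [IsProbabilityMeasure P] (hm₀ : m₀ ≤ mΩ) {Q : Ω → ℝ} (hQm : Measurable Q) {v : NNReal}
    (hQ : P.map Q = gaussianReal 0 v) (hind : Indep m₀ (MeasurableSpace.comap Q inferInstance) P)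
    {c m φ : Ω → ℝ} (hc : Measurable[m₀] c) (hm : Measurable[m₀] m) (hφ : Measurable[m₀] φ)
    {E : Set Ω} (hE : MeasurableSet[m₀] E) (hcv : ∀ ω ∈ E, 3 / 4 ≤ c ω ^ 2 * v) (γ : ℝ) :
    ENNReal.ofReal (|γ| * (9 / 196)) * P E
      ≤ ∫⁻ ω in E, ENNReal.ofReal |γ * Real.cos (c ω * (m ω + Q ω)) - φ ω| ∂P := by
  -- The event `E` is encoded by its indicator as a fourth coordinate of `U`. The integrand becomes
  -- a function of the independent pair (`U`, `Q`), and Fubini reduces the claim to the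
  -- one-dimensional estimate with `U` frozen.
  have hF : Measurable fun z : (ℝ × ℝ × ℝ × ℝ) × ℝ => (if z.1.2.2.2 = 1 ∧ 3 / 4 ≤ z.1.1 ^ 2 * v then
      ENNReal.ofReal |γ * Real.cos (z.1.1 * (z.1.2.1 + z.2)) - z.1.2.2.1| else 0) := by
    refine Measurable.ite ?_ (by fun_prop) measurable_const
    exact (measurableSet_eq_fun (f := fun z : (ℝ × ℝ × ℝ × ℝ) × ℝ => z.1.2.2.2) (by fun_prop)
      measurable_const).inter
      (measurableSet_le measurable_const (g := fun z : (ℝ × ℝ × ℝ × ℝ) × ℝ => z.1.1 ^ 2 * v)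
        (by fun_prop))
  set F : (ℝ × ℝ × ℝ × ℝ) × ℝ → ℝ≥0∞ := fun z => if z.1.2.2.2 = 1 ∧ 3 / 4 ≤ z.1.1 ^ 2 * v then
      ENNReal.ofReal |γ * Real.cos (z.1.1 * (z.1.2.1 + z.2)) - z.1.2.2.1| else 0 with hFdef
  set U : Ω → ℝ × ℝ × ℝ × ℝ := fun ω => (c ω, m ω, φ ω, E.indicator (fun _ => 1) ω) with hU
  have hUm : Measurable[m₀] U := by
    have : Measurable[m₀] (E.indicator fun _ => (1 : ℝ)) := Measurable.indicator measurable_const hE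
    exact Measurable.prodMk hc (Measurable.prodMk hm (Measurable.prodMk hφ this))
  have hUQ : IndepFun U Q P := by
    rw [IndepFun_iff_Indep]
    exact indep_of_indep_of_le_left hind hUm.comap_le
  have hUm' : Measurable U := hUm.mono hm₀ le_rfl
  have hmap := (indepFun_iff_map_prod_eq_prod_map_map hUm'.aemeasurable hQm.aemeasurable).1 hUQ
  have hlhs : ∫⁻ ω in E, ENNReal.ofReal |γ * Real.cos (c ω * (m ω + Q ω)) - φ ω| ∂P
      = ∫⁻ ω, F (U ω, Q ω) ∂P := by
    rw [← lintegral_indicator (hm₀ _ hE)]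
    refine lintegral_congr fun ω => ?_
    by_cases hω : ω ∈ E
    · simp [hFdef, hU, hω, hcv ω hω]
    · simp [hFdef, hU, hω]
  rw [hlhs, ← lintegral_map (f := F) (g := fun ω => (U ω, Q ω)) hF (hUm'.prodMk hQm), hmap,
    lintegral_prod _ hF.aemeasurable, lintegral_map hF.lintegral_prod_right' hUm', hQ,
    ← setLIntegral_const, ← lintegral_indicator (hm₀ _ hE)]
  refine lintegral_mono fun ω => ?_
  by_cases hω : ω ∈ E
  swap
  · simp [hω]
  have hcω := hcv ω hω
  simp only [hω, indicator_of_mem, hFdef, hU, hcω, and_self, if_true]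
  rw [← ofReal_integral_eq_lintegral_ofReal]
  · refine ENNReal.ofReal_le_ofReal ?_
    rcases eq_or_ne γ 0 with rfl | hγ
    · simp
    have e1 : ∀ q, |γ * Real.cos (c ω * (m ω + q)) - φ ω|
        = |γ| * |Real.cos (c ω * m ω + c ω * q) - φ ω / γ| := by
      intro q
      rw [← abs_mul, mul_add]
      congr 1
      field_simp
    simp_rw [e1, integral_const_mul]
    gcongr
    refine le_trans ?_ (integral_abs_cos_sub_gaussianReal_ge v _ _ _)
    -- From exp(3/4) ≥ 7/4; hence the constant (3/7)² / 4 = 9/196.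
    have h1 : Real.exp (-(c ω ^ 2 * v)) ≤ 4 / 7 := by
      rw [Real.exp_neg, inv_le_comm₀ (Real.exp_pos _) (by norm_num)]
      linarith [Real.add_one_le_exp (c ω ^ 2 * v)]
    nlinarith
  · refine Integrable.of_bound (C := |γ| + |φ ω|) (by fun_prop) (ae_of_all _ fun q => ?_)
    rw [Real.norm_eq_abs, abs_abs]
    refine (abs_sub _ _).trans ?_
    refine add_le_add_left ?_ _
    rw [abs_mul]
    exact mul_le_of_le_one_right (abs_nonneg _) (Real.abs_cos_le_one _)
  · exact ae_of_all _ fun q => abs_nonneg _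

/-! ### Isometry for elementary stochastic integrals -/

section Isometry

variable {Ω : Type*} {mΩ : MeasurableSpace Ω} {P : Measure Ω} {T : ℝ}
  {𝓕 : Filtration ℝ mΩ} {W : ℝ → Ω → ℝ}

lemma IsBrownianMotionOn.measurable (hW : IsBrownianMotionOn T 𝓕 W P) {t : ℝ}
    (ht : t ∈ Icc 0 T) : Measurable (W t) :=
  (hW.adapted t ht).mono (𝓕.le t) le_rfl

lemma IsBrownianMotionOn.hasLaw_sub (hW : IsBrownianMotionOn T 𝓕 W P) {s t : ℝ} (hs : 0 ≤ s)
    (hst : s ≤ t) (ht : t ≤ T) :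
    HasLaw (fun ω => W t ω - W s ω) (gaussianReal 0 (t - s).toNNReal) P :=
  ⟨((hW.measurable ⟨hs.trans hst, ht⟩).sub (hW.measurable ⟨hs, hst.trans ht⟩)).aemeasurable,
    hW.law s t hs hst ht⟩

lemma IsBrownianMotionOn.memLp_sub (hW : IsBrownianMotionOn T 𝓕 W P) {s t : ℝ} (hs : 0 ≤ s)
    (hst : s ≤ t) (ht : t ≤ T) : MemLp (fun ω => W t ω - W s ω) 2 P :=
  (hW.hasLaw_sub hs hst ht).hasGaussianLaw.memLp_two

lemma IsBrownianMotionOn.indepFun_sub (hW : IsBrownianMotionOn T 𝓕 W P) {s t : ℝ} (hs : 0 ≤ s)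
    (hst : s ≤ t) (ht : t ≤ T) {G : Ω → ℝ} (hG : Measurable[𝓕 s] G) :
    IndepFun G (fun ω => W t ω - W s ω) P := by
  rw [IndepFun_iff_Indep]
  exact (indep_of_indep_of_le_right (hW.indep s t hs hst ht) hG.comap_le).symm

lemma IsBrownianMotionOn.integral_mul_sub (hW : IsBrownianMotionOn T 𝓕 W P) {s t : ℝ}
    (hs : 0 ≤ s) (hst : s ≤ t) (ht : t ≤ T) {G : Ω → ℝ} (hG : Measurable[𝓕 s] G) :
    ∫ ω, G ω * (W t ω - W s ω) ∂P = 0 := by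
  rw [(hW.indepFun_sub hs hst ht hG).integral_fun_mul_eq_mul_integral
    (hG.mono (𝓕.le s) le_rfl).aestronglyMeasurable
    (hW.memLp_sub hs hst ht).aestronglyMeasurable,
    (hW.hasLaw_sub hs hst ht).integral_eq, integral_id_gaussianReal, mul_zero]

lemma IsBrownianMotionOn.integral_mul_sub_sq (hW : IsBrownianMotionOn T 𝓕 W P) {s t : ℝ}
    (hs : 0 ≤ s) (hst : s ≤ t) (ht : t ≤ T) {G : Ω → ℝ} (hG : Measurable[𝓕 s] G) :
    ∫ ω, G ω * (W t ω - W s ω) ^ 2 ∂P = (∫ ω, G ω ∂P) * (t - s) := by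
  have hlaw := hW.hasLaw_sub hs hst ht
  have h2 : ∫ ω, (W t ω - W s ω) ^ 2 ∂P = t - s := by
    have hv := hlaw.variance_eq
    have h0 : ∫ ω, W t ω - W s ω ∂P = 0 := by
      rw [hlaw.integral_eq, integral_id_gaussianReal]
    rw [variance_of_integral_eq_zero hlaw.aemeasurable h0, variance_id_gaussianReal] at hv
    rw [hv, Real.coe_toNNReal _ (by linarith)]
  rw [← h2]
  exact ((hW.indepFun_sub hs hst ht hG).comp measurable_id
    (measurable_id.pow_const 2)).integral_fun_mul_eq_mul_integral
    (hG.mono (𝓕.le s) le_rfl).aestronglyMeasurable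
    ((hW.memLp_sub hs hst ht).aestronglyMeasurable.pow 2)

lemma integrable_bdd_mul_mul {ξ f g : Ω → ℝ} (hξ : Measurable ξ) {C : ℝ} (hC : ∀ ω, |ξ ω| ≤ C)
    (hf : MemLp f 2 P) (hg : MemLp g 2 P) : Integrable (fun ω => ξ ω * (f ω * g ω)) P :=
  (hf.integrable_mul hg).bdd_mul hξ.aestronglyMeasurable (ae_of_all _ hC)

lemma IsBrownianMotionOn.integral_mul_sub_mul_sub_of_le (hW : IsBrownianMotionOn T 𝓕 W P)
    {a b c : ℝ} (ha : 0 ≤ a) (hab : a ≤ b) (hbc : b ≤ c) (hc : c ≤ T) {ξ : Ω → ℝ}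
    (hξ : Measurable[𝓕 a] ξ) {C : ℝ} (hC : ∀ ω, |ξ ω| ≤ C) :
    ∫ ω, ξ ω * ((W b ω - W a ω) * (W c ω - W a ω)) ∂P = (∫ ω, ξ ω ∂P) * (b - a) := by
  have hξ' : Measurable ξ := hξ.mono (𝓕.le a) le_rfl
  have hba := hW.memLp_sub ha hab (hbc.trans hc)
  have hcb := hW.memLp_sub (ha.trans hab) hbc hc
  have e : ∀ ω, ξ ω * ((W b ω - W a ω) * (W c ω - W a ω))
      = ξ ω * ((W b ω - W a ω) * (W b ω - W a ω)) + ξ ω * ((W b ω - W a ω) * (W c ω - W b ω)) := by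
    intro ω; ring
  simp_rw [e]
  rw [integral_add (integrable_bdd_mul_mul hξ' hC hba hba)
    (integrable_bdd_mul_mul hξ' hC hba hcb)]
  -- The increment after `b` is centred and independent of everything known at time `b`.
  have h1 : ∫ ω, ξ ω * ((W b ω - W a ω) * (W c ω - W b ω)) ∂P = 0 := by
    simp_rw [← mul_assoc]
    refine hW.integral_mul_sub (ha.trans hab) hbc hc (G := fun ω => ξ ω * (W b ω - W a ω)) ?_
    exact (hξ.mono (𝓕.mono hab) le_rfl).mul ((hW.adapted b ⟨ha.trans hab, hbc.trans hc⟩).sub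
      ((hW.adapted a ⟨ha, hab.trans (hbc.trans hc)⟩).mono (𝓕.mono hab) le_rfl))
  rw [h1, add_zero, ← hW.integral_mul_sub_sq ha hab (hbc.trans hc) hξ]
  simp_rw [sq]

/-- The scalar product of two elementary integrands with a single interval. -/
lemma IsBrownianMotionOn.integral_elementary_mul (hW : IsBrownianMotionOn T 𝓕 W P)
    {a b a' b' : ℝ} (ha : 0 ≤ a) (hab : a ≤ b) (hb : b ≤ T) (ha' : 0 ≤ a') (hab' : a' ≤ b')
    (hb' : b' ≤ T) {ξ ξ' : Ω → ℝ} (hξ : Measurable[𝓕 a] ξ) (hξ' : Measurable[𝓕 a'] ξ') {C : ℝ}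
    (hC : ∀ ω, |ξ ω| ≤ C) (hC' : ∀ ω, |ξ' ω| ≤ C) :
    ∫ ω, (ξ ω * (W b ω - W a ω)) * (ξ' ω * (W b' ω - W a' ω)) ∂P
      = (∫ ω, ξ ω * ξ' ω ∂P) * max (min b b' - max a a') 0 := by
  wlog haa : a ≤ a' generalizing a b a' b' ξ ξ'
  · have := this ha' hab' hb' ha hab hb hξ' hξ hC' hC (le_of_not_ge haa)
    rw [min_comm, max_comm a a']
    simp_rw [mul_comm (ξ _) (ξ' _)]
    rw [← this]
    simp_rw [mul_comm]
  have hη : Measurable[𝓕 a'] fun ω => ξ ω * ξ' ω := (hξ.mono (𝓕.mono haa) le_rfl).mul hξ'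
  have hηC : ∀ ω, |ξ ω * ξ' ω| ≤ C * C := fun ω => by
    rw [abs_mul]
    exact mul_le_mul (hC ω) (hC' ω) (abs_nonneg _) ((abs_nonneg _).trans (hC ω))
  have e : ∀ ω, (ξ ω * (W b ω - W a ω)) * (ξ' ω * (W b' ω - W a' ω))
      = (ξ ω * ξ' ω) * ((W b ω - W a ω) * (W b' ω - W a' ω)) := fun ω => by ring
  simp_rw [e]
  rw [max_eq_right haa]
  have hWa : Measurable[𝓕 a'] (W a) :=
    (hW.adapted a ⟨ha, haa.trans (hab'.trans hb')⟩).mono (𝓕.mono haa) le_rfl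
  rcases le_total b a' with hba | hba
  · rw [max_eq_right (by linarith [min_le_left b b']), mul_zero]
    simp_rw [← mul_assoc]
    refine hW.integral_mul_sub ha' hab' hb' (G := fun ω => ξ ω * ξ' ω * (W b ω - W a ω)) ?_
    exact hη.mul (((hW.adapted b ⟨ha.trans hab, hb⟩).mono (𝓕.mono hba) le_rfl).sub hWa)
  have e2 : ∀ ω, (ξ ω * ξ' ω) * ((W b ω - W a ω) * (W b' ω - W a' ω))
      = (ξ ω * ξ' ω) * ((W a' ω - W a ω) * (W b' ω - W a' ω))
        + (ξ ω * ξ' ω) * ((W b ω - W a' ω) * (W b' ω - W a' ω)) := fun ω => by ring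
  have hη' := hη.mono (𝓕.le a') le_rfl
  have hb'a' := hW.memLp_sub ha' hab' hb'
  have hba' := hW.memLp_sub ha' hba hb
  simp_rw [e2]
  rw [integral_add (integrable_bdd_mul_mul hη' hηC
      (hW.memLp_sub ha haa (hab'.trans hb')) hb'a')
    (integrable_bdd_mul_mul hη' hηC hba' hb'a')]
  have h1 : ∫ ω, (ξ ω * ξ' ω) * ((W a' ω - W a ω) * (W b' ω - W a' ω)) ∂P = 0 := by
    simp_rw [← mul_assoc]
    refine hW.integral_mul_sub ha' hab' hb' (G := fun ω => ξ ω * ξ' ω * (W a' ω - W a ω)) ?_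
    exact hη.mul ((hW.adapted a' ⟨ha', hab'.trans hb'⟩).sub hWa)
  rw [h1, zero_add]
  rcases le_total b b' with hbb | hbb
  · rw [min_eq_left hbb, max_eq_left (by linarith)]
    exact hW.integral_mul_sub_mul_sub_of_le ha' hba hbb hb' hη hηC
  · rw [min_eq_right hbb, max_eq_left (by linarith)]
    simp_rw [mul_comm (W b _ - W a' _)]
    exact hW.integral_mul_sub_mul_sub_of_le ha' hab' hbb hb hη hηC

lemma enorm_sq_eq_ofReal (x : ℝ) : ‖x‖ₑ ^ 2 = ENNReal.ofReal (x ^ 2) := by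
  rw [← ofReal_norm, ← ENNReal.ofReal_pow (norm_nonneg _), Real.norm_eq_abs, sq_abs]

/-- The isometry for elementary integrands. -/
lemma IsBrownianMotionOn.lintegral_elementary_sq [IsProbabilityMeasure P]
    (hW : IsBrownianMotionOn T 𝓕 W P) {u : ℝ} (hu : u ≤ T)
    {ι : Type*} [Fintype ι] {a b : ι → ℝ} (ha : ∀ i, 0 ≤ a i) (hab : ∀ i, a i ≤ b i)
    (hb : ∀ i, b i ≤ u) {ξ : ι → Ω → ℝ} (hξ : ∀ i, Measurable[𝓕 (a i)] (ξ i)) {C : ℝ}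
    (hC : ∀ i ω, |ξ i ω| ≤ C) :
    ∫⁻ ω, ‖∑ i, ξ i ω * (W (b i) ω - W (a i) ω)‖ₑ ^ 2 ∂P
      = ∫⁻ ω, (∫⁻ s in Icc 0 u, ‖∑ i, (Ioc (a i) (b i)).indicator (fun _ => ξ i ω) s‖ₑ ^ 2) ∂P := by
  have hb' : ∀ i, b i ≤ T := fun i => (hb i).trans hu
  have hξm : ∀ i, Measurable (ξ i) := fun i => (hξ i).mono (𝓕.le _) le_rfl
  have hξξ : ∀ i j, Integrable (fun ω => ξ i ω * ξ j ω) P := fun i j => by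
    refine Integrable.of_bound (C := C * C) ((hξm i).mul (hξm j)).aestronglyMeasurable
      (ae_of_all _ fun ω => ?_)
    rw [norm_mul]
    exact mul_le_mul (hC i ω) (hC j ω) (abs_nonneg _) ((abs_nonneg _).trans (hC i ω))
  have hmem : ∀ i, MemLp (fun ω => ξ i ω * (W (b i) ω - W (a i) ω)) 2 P := fun i =>
    (hW.memLp_sub (ha i) (hab i) (hb' i)).mul (p := ∞) (q := 2) (r := 2)
      (memLp_top_of_bound (hξm i).aestronglyMeasurable C (ae_of_all _ (hC i)))
  have hsum : MemLp (fun ω => ∑ i, ξ i ω * (W (b i) ω - W (a i) ω)) 2 P :=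
    memLp_finsetSum _ fun i _ => hmem i
  -- Both sides expand to the same double sum weighted by the lengths of pairwise overlaps. The
  -- intervals may overlap arbitrarily, so two unrelated partitions can be compared without a common
  -- refinement.
  have hlhs : ∫ ω, (∑ i, ξ i ω * (W (b i) ω - W (a i) ω)) ^ 2 ∂P
      = ∑ i, ∑ j, (∫ ω, ξ i ω * ξ j ω ∂P) * max (min (b i) (b j) - max (a i) (a j)) 0 := by
    have hint : ∀ i j, Integrable (fun ω => ξ i ω * (W (b i) ω - W (a i) ω)
        * (ξ j ω * (W (b j) ω - W (a j) ω))) P := fun i j => (hmem i).integrable_mul (hmem j)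
    simp_rw [sq, Finset.sum_mul_sum]
    rw [integral_finsetSum _ fun i _ => integrable_finsetSum _ fun j _ => hint i j]
    refine Finset.sum_congr rfl fun i _ => ?_
    rw [integral_finsetSum _ fun j _ => hint i j]
    exact Finset.sum_congr rfl fun j _ => hW.integral_elementary_mul (ha i) (hab i) (hb' i)
      (ha j) (hab j) (hb' j) (hξ i) (hξ j) (hC i) (hC j)
  have hinner : ∀ ω, 0 ≤ ∑ i, ∑ j, ξ i ω * ξ j ω * max (min (b i) (b j) - max (a i) (a j)) 0 ∧
      ∫⁻ s in Icc 0 u, ‖∑ i, (Ioc (a i) (b i)).indicator (fun _ => ξ i ω) s‖ₑ ^ 2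
      = ENNReal.ofReal (∑ i, ∑ j, ξ i ω * ξ j ω * max (min (b i) (b j) - max (a i) (a j)) 0) := by
    intro ω
    have hint : ∀ i j, Integrable (fun s => (Ioc (a i) (b i)).indicator (fun _ => ξ i ω) s
        * (Ioc (a j) (b j)).indicator (fun _ => ξ j ω) s) (volume.restrict (Icc 0 u)) := by
      intro i j
      refine Integrable.of_bound (C := |ξ i ω| * |ξ j ω|) ?_ (ae_of_all _ fun s => ?_)
      · exact ((measurable_const.indicator measurableSet_Ioc).mul
          (measurable_const.indicator measurableSet_Ioc)).aestronglyMeasurable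
      · rw [norm_mul]
        exact mul_le_mul (norm_indicator_le_norm_self _ _) (norm_indicator_le_norm_self _ _)
          (norm_nonneg _) (abs_nonneg _)
    have h2 : ∫ s in Icc 0 u, (∑ i, (Ioc (a i) (b i)).indicator (fun _ => ξ i ω) s) ^ 2
        = ∑ i, ∑ j, ξ i ω * ξ j ω * max (min (b i) (b j) - max (a i) (a j)) 0 := by
      simp_rw [sq, Finset.sum_mul_sum]
      rw [integral_finsetSum _ fun i _ => integrable_finsetSum _ fun j _ => hint i j]
      refine Finset.sum_congr rfl fun i _ => ?_
      rw [integral_finsetSum _ fun j _ => hint i j]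
      refine Finset.sum_congr rfl fun j _ => ?_
      simp_rw [← Set.inter_indicator_mul, Ioc_inter_Ioc]
      rw [setIntegral_indicator measurableSet_Ioc, setIntegral_const, smul_eq_mul, mul_comm]
      rcases le_or_gt (min (b i) (b j)) (max (a i) (a j)) with hle | hlt
      · simp [hle]
      · have : Icc 0 u ∩ Ioc (max (a i) (a j)) (min (b i) (b j))
            = Ioc (max (a i) (a j)) (min (b i) (b j)) := by
          refine inter_eq_self_of_subset_right fun s hs => ⟨?_, ?_⟩
          · exact (ha i).trans ((le_max_left _ _).trans hs.1.le)
          · exact hs.2.trans ((min_le_left _ _).trans (hb i))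
        rw [this, Real.volume_real_Ioc]
    rw [← h2]
    refine ⟨integral_nonneg fun s => sq_nonneg _, ?_⟩
    rw [ofReal_integral_eq_lintegral_ofReal]
    · simp_rw [enorm_sq_eq_ofReal]
    · simp_rw [sq, Finset.sum_mul_sum]
      exact integrable_finsetSum _ fun i _ => integrable_finsetSum _ fun j _ => hint i j
    · exact ae_of_all _ fun s => sq_nonneg _
  simp_rw [(hinner _).2, enorm_sq_eq_ofReal]
  have hint : ∀ i j, Integrable (fun ω => ξ i ω * ξ j ω * max (min (b i) (b j) - max (a i) (a j)) 0)
    P := fun i j => (hξξ i j).mul_const _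
  rw [← ofReal_integral_eq_lintegral_ofReal hsum.integrable_sq (ae_of_all _ fun ω => sq_nonneg _),
    ← ofReal_integral_eq_lintegral_ofReal _ 
      (ae_of_all _ fun ω => (hinner ω).1), hlhs]
  · rw [integral_finsetSum _ fun i _ => integrable_finsetSum _ fun j _ => hint i j]
    congr 1
    refine Finset.sum_congr rfl fun i _ => ?_
    rw [integral_finsetSum _ fun j _ => hint i j]
    exact Finset.sum_congr rfl fun j _ => (integral_mul_const _ _).symm
  · exact integrable_finsetSum _ fun i _ => integrable_finsetSum _ fun j _ => hint i j

end Isometry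

/-! ### Riemann sums -/

/-- The points of the equidistant partition of `[0, u]` into `m + 1` intervals. -/
noncomputable def gridPt (u : ℝ) (m i : ℕ) : ℝ := u * i / (m + 1)

/-- The step function which approximates `φ` on `[0, u]` from the left. -/
noncomputable def stepFn (u : ℝ) (φ : ℝ → ℝ) (m : ℕ) (s : ℝ) : ℝ :=
  ∑ i : Fin (m + 1), (Ioc (gridPt u m i) (gridPt u m (i + 1))).indicator
    (fun _ => φ (gridPt u m i)) s

/-- The left Riemann sum for `∫ φ dw` over `[0, u]`. -/
noncomputable def riemannSum (u : ℝ) (φ w : ℝ → ℝ) (m : ℕ) : ℝ :=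
  ∑ i : Fin (m + 1), φ (gridPt u m i) * (w (gridPt u m (i + 1)) - w (gridPt u m i))

section Riemann

variable {u : ℝ} {φ w : ℝ → ℝ} {m : ℕ}

@[simp] lemma gridPt_zero : gridPt u m 0 = 0 := by simp [gridPt]

lemma gridPt_last : gridPt u m (m + 1) = u := by
  have : (m : ℝ) + 1 ≠ 0 := by positivity
  simp [gridPt, this]

lemma gridPt_mono (hu : 0 ≤ u) : Monotone (gridPt u m) := fun i j h => by
  simp only [gridPt]
  gcongr

lemma gridPt_succ_sub (i : ℕ) : gridPt u m (i + 1) - gridPt u m i = u / (m + 1) := by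
  simp only [gridPt]
  push_cast
  ring

lemma gridPt_mem (hu : 0 ≤ u) {i : ℕ} (hi : i ≤ m + 1) : gridPt u m i ∈ Icc 0 u := by
  constructor
  · have := gridPt_mono (m := m) hu (Nat.zero_le i); simpa using this
  · have := gridPt_mono (m := m) hu hi; rwa [gridPt_last] at this

lemma sum_indicator_Ioc_eq_zero {t : ℕ → ℝ} (ht : Monotone t) (c : ℕ → ℝ) {n : ℕ} {s : ℝ}
    (hs : t n < s) : ∑ i ∈ Finset.range n, (Ioc (t i) (t (i + 1))).indicator (fun _ => c i) s = 0 :=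
  Finset.sum_eq_zero fun _ hi => indicator_of_notMem (fun h => absurd (h.2.trans
    (ht (Finset.mem_range.1 hi))) (not_le.2 hs)) _

lemma exists_sum_indicator_Ioc {t : ℕ → ℝ} (ht : Monotone t) (c : ℕ → ℝ) {n : ℕ} {s : ℝ}
    (hs : s ∈ Ioc (t 0) (t n)) : ∃ k < n, s ∈ Ioc (t k) (t (k + 1)) ∧
      ∑ i ∈ Finset.range n, (Ioc (t i) (t (i + 1))).indicator (fun _ => c i) s = c k := by
  induction n with
  | zero => exact absurd (hs.1.trans_le hs.2) (lt_irrefl _)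
  | succ n ih =>
    rcases le_or_gt s (t n) with h | h
    · obtain ⟨k, hk, hsk, hsum⟩ := ih ⟨hs.1, h⟩
      refine ⟨k, by omega, hsk, ?_⟩
      rw [Finset.sum_range_succ, hsum, indicator_of_notMem (fun h' => absurd h'.1 (not_lt.2 h)),
        add_zero]
    · refine ⟨n, by omega, ⟨h, hs.2⟩, ?_⟩
      rw [Finset.sum_range_succ, sum_indicator_Ioc_eq_zero ht c h, zero_add]
      exact indicator_of_mem (show s ∈ Ioc (t n) (t (n + 1)) from ⟨h, hs.2⟩) _

lemma exists_stepFn_eq (hu : 0 ≤ u) (φ : ℝ → ℝ) (m : ℕ) {s : ℝ} (hs : s ∈ Ioc 0 u) :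
    ∃ r ∈ Icc 0 u, |s - r| ≤ u / (m + 1) ∧ stepFn u φ m s = φ r := by
  have hs' : s ∈ Ioc (gridPt u m 0) (gridPt u m (m + 1)) := by rwa [gridPt_zero, gridPt_last]
  obtain ⟨k, hk, hsk, hsum⟩ :=
    exists_sum_indicator_Ioc (gridPt_mono hu) (fun i => φ (gridPt u m i)) hs'
  refine ⟨gridPt u m k, gridPt_mem hu hk.le, ?_, ?_⟩
  · rw [abs_of_pos (sub_pos.2 hsk.1), ← gridPt_succ_sub k]
    linarith [hsk.2]
  · rw [← hsum, stepFn, Finset.sum_range]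

lemma tendsto_mesh (u : ℝ) : Tendsto (fun m : ℕ => u / ((m : ℝ) + 1)) atTop (𝓝 0) :=
  tendsto_const_div_atTop_nhds_zero_nat u |>.comp (tendsto_add_atTop_nat 1) |>.congr fun m => by
    simp

lemma measurable_stepFn : Measurable (stepFn u φ m) :=
  Finset.measurable_fun_sum _ fun _ _ => measurable_const.indicator measurableSet_Ioc

lemma tendsto_stepFn (hu : 0 ≤ u) (hφ : ContinuousOn φ (Icc 0 u)) {s : ℝ} (hs : s ∈ Ioc 0 u) :
    Tendsto (fun m => stepFn u φ m s) atTop (𝓝 (φ s)) := by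
  choose r hr hrs hrφ using fun m => exists_stepFn_eq hu φ m hs
  simp_rw [hrφ]
  refine (hφ s (Ioc_subset_Icc_self hs)).tendsto.comp ?_
  rw [tendsto_nhdsWithin_iff]
  refine ⟨?_, Eventually.of_forall hr⟩
  rw [tendsto_iff_dist_tendsto_zero]
  refine squeeze_zero (fun _ => dist_nonneg) (fun m => ?_) (tendsto_mesh u)
  rw [dist_comm, Real.dist_eq]
  exact hrs m

lemma abs_stepFn_le (hu : 0 ≤ u) {C : ℝ} (hC : ∀ s ∈ Icc 0 u, |φ s| ≤ C) {s : ℝ}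
    (hs : s ∈ Ioc 0 u) : |stepFn u φ m s| ≤ C := by
  obtain ⟨r, hr, -, h⟩ := exists_stepFn_eq hu φ m hs
  rw [h]
  exact hC r hr

lemma tendsto_lintegral_stepFn_sub_sq (hu : 0 ≤ u) (hφ : ContinuousOn φ (Icc 0 u)) :
    Tendsto (fun m => ∫⁻ s in Icc 0 u, ‖stepFn u φ m s - φ s‖ₑ ^ 2) atTop (𝓝 0) := by
  obtain ⟨C, hC⟩ := isCompact_Icc.exists_bound_of_continuousOn hφ
  -- The step function is built on left-open intervals and vanishes at 0, so that point is discarded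
  -- as a null set.
  have hae : ∀ᵐ s ∂volume.restrict (Icc 0 u), s ∈ Ioc 0 u := by
    rw [← restrict_Ioc_eq_restrict_Icc]
    exact ae_restrict_mem measurableSet_Ioc
  have hm : AEMeasurable φ (volume.restrict (Icc 0 u)) := hφ.aemeasurable measurableSet_Icc
  have h := tendsto_lintegral_of_dominated_convergence' (μ := volume.restrict (Icc 0 u))
    (F := fun m s => ‖stepFn u φ m s - φ s‖ₑ ^ 2) (f := fun _ => 0)
    (fun _ => ENNReal.ofReal ((2 * C) ^ 2))
    (fun m => (measurable_stepFn.aemeasurable.sub hm).enorm.pow_const 2)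
    (fun m => by
      filter_upwards [hae] with s hs
      rw [enorm_sq_eq_ofReal]
      refine ENNReal.ofReal_le_ofReal ?_
      rw [← sq_abs]
      gcongr
      refine (abs_sub _ _).trans ?_
      have h1 := abs_stepFn_le (m := m) hu hC hs
      have h2 : |φ s| ≤ C := hC s (Ioc_subset_Icc_self hs)
      linarith)
    (by simp [ENNReal.mul_eq_top])
    (by
      filter_upwards [hae] with s hs
      have h1 := (tendsto_stepFn hu hφ hs).sub_const (φ s)
      rw [sub_self] at h1
      have h2 := ENNReal.Tendsto.pow (n := 2) ((continuous_enorm.tendsto (0 : ℝ)).comp h1)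
      simpa using h2)
  simpa using h

/-- Summation by parts moves the increments from `w` to `φ`. This needs only continuity of `w`, so
stochastic integrals of smooth functions can be treated path by path. -/
lemma tendsto_riemannSum (hu : 0 ≤ u) (hφ : ContDiff ℝ 1 φ) (hw : ContinuousOn w (Icc 0 u)) :
    Tendsto (riemannSum u φ w) atTop
      (𝓝 (φ u * w u - φ 0 * w 0 - ∫ s in (0 : ℝ)..u, deriv φ s * w s)) := by
  have hφ' : Continuous (deriv φ) := hφ.continuous_deriv le_rfl
  obtain ⟨C, hC⟩ := (isCompact_Icc (a := (0 : ℝ)) (b := u)).exists_bound_of_continuousOn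
    hφ'.continuousOn
  have hC0 : 0 ≤ C := (norm_nonneg _).trans (hC 0 ⟨le_rfl, hu⟩)
  have huc := isCompact_Icc.uniformContinuousOn_of_continuous hw
  rw [Metric.uniformContinuousOn_iff_le] at huc
  rw [Metric.tendsto_atTop]
  intro ε hε
  -- The total error is at most C u η; the added 1 keeps the denominator positive when C u = 0.
  set η := ε / (2 * (C * u + 1)) with hη
  have hCu : 0 ≤ C * u := mul_nonneg hC0 hu
  have hηpos : 0 < η := by positivity
  obtain ⟨d, hd, hdw⟩ := huc η hηpos
  obtain ⟨M, hM⟩ := (((tendsto_mesh u).eventually (gt_mem_nhds hd)).exists_forall_of_atTop)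
  refine ⟨M, fun m hm => ?_⟩
  set t := gridPt u m with ht
  have htm : ∀ i, i ≤ m + 1 → t i ∈ Icc 0 u := fun i hi => gridPt_mem hu hi
  have hii : ∀ i < m + 1, IntervalIntegrable (fun s => deriv φ s * w s) volume (t i) (t (i + 1)) := by
    intro i hi
    refine ContinuousOn.intervalIntegrable (hφ'.continuousOn.mul (hw.mono ?_))
    exact uIcc_subset_Icc (htm i hi.le) (htm (i + 1) hi)
  have h1 : riemannSum u φ w m = φ u * w u - φ 0 * w 0
      - ∑ i ∈ Finset.range (m + 1), w (t (i + 1)) * (φ (t (i + 1)) - φ (t i)) := by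
    have h2 := Finset.sum_range_sub (fun i => φ (t i) * w (t i)) (m + 1)
    rw [ht, gridPt_zero, gridPt_last] at h2
    rw [riemannSum, ← h2, ← Finset.sum_sub_distrib, ← Finset.sum_range
      (fun i => φ (gridPt u m i) * (w (gridPt u m (i + 1)) - w (gridPt u m i)))]
    refine Finset.sum_congr rfl fun i _ => ?_
    ring
  have h3 : ∫ s in (0 : ℝ)..u, deriv φ s * w s
      = ∑ i ∈ Finset.range (m + 1), ∫ s in t i..t (i + 1), deriv φ s * w s := by
    rw [intervalIntegral.sum_integral_adjacent_intervals hii, ht, gridPt_zero, gridPt_last]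
  have h4 : ∀ i, w (t (i + 1)) * (φ (t (i + 1)) - φ (t i))
      = ∫ s in t i..t (i + 1), deriv φ s * w (t (i + 1)) := by
    intro i
    rw [intervalIntegral.integral_mul_const, intervalIntegral.integral_deriv_eq_sub
      (fun x _ => (hφ.differentiable one_ne_zero) x) (hφ'.intervalIntegrable _ _), mul_comm]
  rw [h1, h3, dist_eq_norm]
  have h5 : φ u * w u - φ 0 * w 0
      - ∑ i ∈ Finset.range (m + 1), w (t (i + 1)) * (φ (t (i + 1)) - φ (t i))
      - (φ u * w u - φ 0 * w 0 - ∑ i ∈ Finset.range (m + 1), ∫ s in t i..t (i + 1), deriv φ s * w s)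
      = ∑ i ∈ Finset.range (m + 1), ∫ s in t i..t (i + 1), deriv φ s * (w s - w (t (i + 1))) := by
    rw [sub_sub_sub_cancel_left, ← Finset.sum_sub_distrib]
    refine Finset.sum_congr rfl fun i hi => ?_
    rw [h4]
    simp_rw [mul_sub (deriv φ _)]
    rw [intervalIntegral.integral_sub (hii i (Finset.mem_range.1 hi))
      (Continuous.intervalIntegrable (by fun_prop) _ _)]
  rw [h5]
  have h6 : ∀ i ∈ Finset.range (m + 1),
      ‖∫ s in t i..t (i + 1), deriv φ s * (w s - w (t (i + 1)))‖ ≤ C * η * (u / (m + 1)) := by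
    intro i hi
    have hi' := Finset.mem_range.1 hi
    have hle : t i ≤ t (i + 1) := gridPt_mono hu (Nat.le_succ i)
    rw [← gridPt_succ_sub i, ← abs_of_nonneg (sub_nonneg.2 hle)]
    refine intervalIntegral.norm_integral_le_of_norm_le_const fun s hs => ?_
    rw [uIoc_of_le hle] at hs
    have hs0 : s ∈ Icc 0 u := ⟨(htm i hi'.le).1.trans hs.1.le, hs.2.trans (htm (i + 1) hi').2⟩
    rw [norm_mul]
    refine mul_le_mul (hC s hs0) ?_ (norm_nonneg _) hC0
    rw [← dist_eq_norm]
    refine hdw s hs0 _ (htm (i + 1) hi') ?_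
    rw [dist_comm, Real.dist_eq, abs_of_nonneg (by linarith [hs.2])]
    have := gridPt_succ_sub (u := u) (m := m) i
    linarith [hs.1, hM m hm]
  refine (norm_sum_le_of_le _ h6).trans_lt ?_
  rw [Finset.sum_const, Finset.card_range, nsmul_eq_mul]
  have h7 : ((m + 1 : ℕ) : ℝ) * (C * η * (u / (m + 1))) = C * u * η := by
    push_cast
    have : (m : ℝ) + 1 ≠ 0 := by positivity
    field_simp
  rw [h7, hη, ← mul_div_assoc, div_lt_iff₀ (by positivity)]
  nlinarith

end Riemann

/-! ### Stochastic integrals of deterministic functions -/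

section ItoIntegral

variable {Ω : Type*} {mΩ : MeasurableSpace Ω} {P : Measure Ω} {T : ℝ}
  {𝓕 : Filtration ℝ mΩ} {W : ℝ → Ω → ℝ}

lemma enorm_add_sq_le (x y : ℝ) : ‖x + y‖ₑ ^ 2 ≤ 2 * ‖x‖ₑ ^ 2 + 2 * ‖y‖ₑ ^ 2 := by
  have h := enorm_sq_eq_ofReal
  rw [h, h, h]
  have e : (2 : ℝ≥0∞) = ENNReal.ofReal 2 := by simp
  rw [e, ← ENNReal.ofReal_mul (by norm_num), ← ENNReal.ofReal_mul (by norm_num),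
    ← ENNReal.ofReal_add (by positivity) (by positivity)]
  refine ENNReal.ofReal_le_ofReal ?_
  nlinarith [sq_nonneg (x - y)]

lemma enorm_sub_sq_le (x y z : ℝ) : ‖x - z‖ₑ ^ 2 ≤ 2 * ‖x - y‖ₑ ^ 2 + 2 * ‖y - z‖ₑ ^ 2 := by
  simpa using enorm_add_sq_le (x - y) (y - z)

lemma IsBrownianMotionOn.lintegral_riemannSum_sq [IsProbabilityMeasure P]
    (hW : IsBrownianMotionOn T 𝓕 W P) {u : ℝ} (hu : u ∈ Icc 0 T) (φ : ℝ → ℝ) (m : ℕ) :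
    ∫⁻ ω, ‖riemannSum u φ (fun t => W t ω) m‖ₑ ^ 2 ∂P
      = ∫⁻ s in Icc 0 u, ‖stepFn u φ m s‖ₑ ^ 2 := by
  have h := hW.lintegral_elementary_sq hu.2 (ι := Fin (m + 1)) (a := fun i => gridPt u m i)
    (b := fun i => gridPt u m (i + 1)) (fun i => (gridPt_mem hu.1 i.2.le).1)
    (fun i => gridPt_mono hu.1 (Nat.le_succ _)) (fun i => (gridPt_mem hu.1 i.2).2)
    (ξ := fun i _ => φ (gridPt u m i)) (fun i => measurable_const)
    (C := ∑ i : Fin (m + 1), |φ (gridPt u m i)|)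
    (fun i _ => Finset.single_le_sum (f := fun i : Fin (m + 1) => |φ (gridPt u m i)|)
      (fun j _ => abs_nonneg _) (Finset.mem_univ i))
  simpa [riemannSum, stepFn] using h

/-- The two partitions are merged into one family of intervals indexed by a sum type, truncated at
`u`, with the coefficients of `Z` negated; then the elementary isometry applies. -/
lemma IsBrownianMotionOn.lintegral_riemannSum_sub_integral_sq [IsProbabilityMeasure P]
    (hW : IsBrownianMotionOn T 𝓕 W P) {u : ℝ} (hu : u ∈ Icc 0 T) (φ : ℝ → ℝ) (m : ℕ)
    (Z : SimpleIntegrand T 𝓕) :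
    ∫⁻ ω, ‖riemannSum u φ (fun t => W t ω) m - Z.integral W u ω‖ₑ ^ 2 ∂P
      = ∫⁻ ω, (∫⁻ s in Icc 0 u, ‖stepFn u φ m s - Z.val s ω‖ₑ ^ 2) ∂P := by
  obtain ⟨C, hC⟩ := Z.bdd
  have hC0 : ∀ ω : Ω, 0 ≤ C := fun ω => (abs_nonneg _).trans (hC 0 ω)
  have hZ : ∀ i, 0 ≤ Z.t i := fun i => (Z.mem i).1
  have h := hW.lintegral_elementary_sq hu.2 (ι := Fin (m + 1) ⊕ Fin Z.n)
    (a := Sum.elim (fun i => gridPt u m i) (fun i => min (Z.t i) u))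
    (b := Sum.elim (fun i => gridPt u m (i + 1)) (fun i => min (Z.t (i + 1)) u))
    (by
      rintro (i | i)
      · exact (gridPt_mem hu.1 i.2.le).1
      · exact le_min (hZ _) hu.1)
    (by
      rintro (i | i)
      · exact gridPt_mono hu.1 (Nat.le_succ _)
      · exact min_le_min_right _ (Z.mono (Nat.le_succ _)))
    (by
      rintro (i | i)
      · exact (gridPt_mem hu.1 i.2).2
      · exact min_le_right _ _)
    -- If `Z.t i` exceeds `u`, the truncated interval is empty and its left end is `u`, where `Z.ξ
    -- i` need not be measurable; its coefficient is replaced by 0.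
    (ξ := Sum.elim (fun i _ => φ (gridPt u m i))
      (fun i ω => if Z.t i ≤ u then - Z.ξ i ω else 0))
    (by
      rintro (i | i)
      · exact measurable_const
      · simp only [Sum.elim_inr]
        split_ifs with hi
        · have := (Z.meas i).neg
          rwa [← min_eq_left hi] at this
        · exact measurable_const)
    (C := (∑ i : Fin (m + 1), |φ (gridPt u m i)|) + C)
    (by
      rintro (i | i) ω
      · refine le_add_of_le_of_nonneg ?_ (hC0 ω)
        exact Finset.single_le_sum (f := fun i : Fin (m + 1) => |φ (gridPt u m i)|)
          (fun j _ => abs_nonneg _) (Finset.mem_univ i)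
      · refine le_add_of_nonneg_of_le (Finset.sum_nonneg fun i _ => abs_nonneg _) ?_
        simp only [Sum.elim_inr]
        split_ifs
        · rw [abs_neg]; exact hC _ _
        · simpa using hC0 ω)
  simp only [Fintype.sum_sum_type, Sum.elim_inl, Sum.elim_inr] at h
  have e1 : ∀ ω, riemannSum u φ (fun t => W t ω) m - Z.integral W u ω
      = ∑ i : Fin (m + 1), φ (gridPt u m i) * (W (gridPt u m (i + 1)) ω - W (gridPt u m i) ω)
        + ∑ i : Fin Z.n, (if Z.t i ≤ u then - Z.ξ i ω else 0)
          * (W (min (Z.t (i + 1)) u) ω - W (min (Z.t i) u) ω) := by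
    intro ω
    rw [riemannSum, SimpleIntegrand.integral, Finset.sum_range, sub_eq_add_neg,
      ← Finset.sum_neg_distrib]
    congr 1
    refine Finset.sum_congr rfl fun i _ => ?_
    split_ifs with hi
    · ring
    · have h1 : u ≤ Z.t i := (not_le.1 hi).le
      rw [min_eq_right h1, min_eq_right (h1.trans (Z.mono (Nat.le_succ _)))]
      ring
  have e2 : ∀ ω, ∀ s ∈ Icc 0 u, stepFn u φ m s - Z.val s ω
      = ∑ i : Fin (m + 1), (Ioc (gridPt u m i) (gridPt u m (i + 1))).indicator
          (fun _ => φ (gridPt u m i)) s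
        + ∑ i : Fin Z.n, (Ioc (min (Z.t i) u) (min (Z.t (i + 1)) u)).indicator
          (fun _ => if Z.t i ≤ u then - Z.ξ i ω else 0) s := by
    intro ω s hs
    rw [stepFn, SimpleIntegrand.val, Finset.sum_range, sub_eq_add_neg, ← Finset.sum_neg_distrib]
    congr 1
    refine Finset.sum_congr rfl fun i _ => ?_
    have hs2 := hs.2
    simp only [indicator, mem_Ioc, min_lt_iff, le_min_iff]
    by_cases hi : Z.t i ≤ u
    · have : (Z.t i < s ∨ u < s) ↔ Z.t i < s := or_iff_left (not_lt.2 hs2)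
      simp only [hi, if_true, this, hs2, and_true]
      split_ifs <;> simp
    · have : ¬ Z.t i < s := fun h' => hi (h'.le.trans hs2)
      simp [this, hi]
  simp_rw [e1]
  rw [h]
  exact lintegral_congr fun ω => (setLIntegral_congr_fun measurableSet_Icc fun s hs => by
    simp only [e2 ω s hs]).symm

/-- The Itô integral of a deterministic smooth function. -/
lemma IsItoIntegral.ae_eq_of_deterministic [IsProbabilityMeasure P]
    (hW : IsBrownianMotionOn T 𝓕 W P) {u : ℝ} (hu : u ∈ Icc 0 T) {H : ℝ → Ω → ℝ} {I : Ω → ℝ}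
    (hI : IsItoIntegral T 𝓕 P W u H I) (hIm : AEMeasurable I P) {φ : ℝ → ℝ}
    (hφ : ContDiff ℝ 1 φ) (hH : ∀ᵐ ω ∂P, ∀ s ∈ Icc 0 u, H s ω = φ s) :
    ∀ᵐ ω ∂P, I ω = φ u * W u ω - ∫ s in (0 : ℝ)..u, deriv φ s * W s ω := by
  obtain ⟨Z, hZ1, hZ2⟩ := hI
  set J : ℕ → Ω → ℝ := fun m ω => riemannSum u φ (fun t => W t ω) m with hJ
  set κ : ℕ → ℝ≥0∞ := fun m => ∫⁻ s in Icc 0 u, ‖stepFn u φ m s - φ s‖ₑ ^ 2 with hκ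
  have hmW : ∀ t ∈ Icc 0 u, Measurable (W t) := fun t ht => hW.measurable ⟨ht.1, ht.2.trans hu.2⟩
  have hJm : ∀ m, Measurable (J m) := fun m => by
    refine Finset.measurable_fun_sum _ fun i _ => Measurable.const_mul ?_ _
    exact (hmW _ (gridPt_mem hu.1 i.2)).sub (hmW _ (gridPt_mem hu.1 i.2.le))
  have hZm : ∀ k, Measurable ((Z k).integral W u) := fun k => by
    refine Finset.measurable_fun_sum _ fun i _ => ?_
    refine (((Z k).meas i).mono (𝓕.le _) le_rfl).mul (Measurable.sub ?_ ?_)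
    · exact hmW _ ⟨le_min ((Z k).mem _).1 hu.1, min_le_right _ _⟩
    · exact hmW _ ⟨le_min ((Z k).mem _).1 hu.1, min_le_right _ _⟩
  -- The simple integrands `Z k` serve only as intermediaries: the triangle inequality and the
  -- isometry give a bound for each `k`, and the terms depending on `k` vanish in the limit.
  have hbound : ∀ m, ∫⁻ ω, ‖J m ω - I ω‖ₑ ^ 2 ∂P ≤ 4 * κ m := by
    intro m
    have h1 : ∀ k, ∫⁻ ω, ‖J m ω - I ω‖ₑ ^ 2 ∂P
        ≤ 4 * κ m + (4 * ∫⁻ ω, (∫⁻ s in Icc 0 u, ‖(Z k).val s ω - H s ω‖ₑ ^ 2) ∂P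
          + 2 * ∫⁻ ω, ‖(Z k).integral W u ω - I ω‖ₑ ^ 2 ∂P) := by
      intro k
      have hstep : ∫⁻ ω, (∫⁻ s in Icc 0 u, ‖stepFn u φ m s - (Z k).val s ω‖ₑ ^ 2) ∂P
          ≤ 2 * κ m + 2 * ∫⁻ ω, (∫⁻ s in Icc 0 u, ‖(Z k).val s ω - H s ω‖ₑ ^ 2) ∂P := by
        have h2 : ∀ᵐ ω ∂P, ∫⁻ s in Icc 0 u, ‖stepFn u φ m s - (Z k).val s ω‖ₑ ^ 2
            ≤ 2 * κ m + 2 * ∫⁻ s in Icc 0 u, ‖(Z k).val s ω - H s ω‖ₑ ^ 2 := by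
          filter_upwards [hH] with ω hω
          have hm1 : Measurable fun s => 2 * ‖stepFn u φ m s - φ s‖ₑ ^ 2 :=
            ((measurable_stepFn.sub hφ.continuous.measurable).enorm.pow_const 2).const_mul 2
          calc ∫⁻ s in Icc 0 u, ‖stepFn u φ m s - (Z k).val s ω‖ₑ ^ 2
              ≤ ∫⁻ s in Icc 0 u, (2 * ‖stepFn u φ m s - φ s‖ₑ ^ 2
                  + 2 * ‖(Z k).val s ω - H s ω‖ₑ ^ 2) := by
                refine setLIntegral_mono' measurableSet_Icc fun s hs => ?_
                rw [hω s hs, ← enorm_neg ((Z k).val s ω - φ s), neg_sub]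
                exact enorm_sub_sq_le _ _ _
            _ = _ := by
                rw [lintegral_add_left hm1, lintegral_const_mul' _ _ (by simp),
                  lintegral_const_mul' _ _ (by simp)]
        refine (lintegral_mono_ae h2).trans ?_
        rw [lintegral_add_left measurable_const, lintegral_const, measure_univ, mul_one,
          lintegral_const_mul' _ _ (by simp)]
      calc ∫⁻ ω, ‖J m ω - I ω‖ₑ ^ 2 ∂P
          ≤ ∫⁻ ω, (2 * ‖J m ω - (Z k).integral W u ω‖ₑ ^ 2
              + 2 * ‖(Z k).integral W u ω - I ω‖ₑ ^ 2) ∂P :=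
            lintegral_mono fun ω => enorm_sub_sq_le _ _ _
        _ = 2 * ∫⁻ ω, ‖J m ω - (Z k).integral W u ω‖ₑ ^ 2 ∂P
              + 2 * ∫⁻ ω, ‖(Z k).integral W u ω - I ω‖ₑ ^ 2 ∂P := by
            have hm1 : Measurable fun ω => 2 * ‖J m ω - (Z k).integral W u ω‖ₑ ^ 2 :=
              (((hJm m).sub (hZm k)).enorm.pow_const 2).const_mul 2
            rw [lintegral_add_left hm1,
              lintegral_const_mul' _ _ (by simp), lintegral_const_mul' _ _ (by simp)]
        _ ≤ 2 * (2 * κ m + 2 * ∫⁻ ω, (∫⁻ s in Icc 0 u, ‖(Z k).val s ω - H s ω‖ₑ ^ 2) ∂P)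
              + 2 * ∫⁻ ω, ‖(Z k).integral W u ω - I ω‖ₑ ^ 2 ∂P := by
            gcongr
            rw [hJ, hW.lintegral_riemannSum_sub_integral_sq hu φ m (Z k)]
            exact hstep
        _ = _ := by ring
    have h2 : Tendsto (fun k => 4 * κ m
        + (4 * ∫⁻ ω, (∫⁻ s in Icc 0 u, ‖(Z k).val s ω - H s ω‖ₑ ^ 2) ∂P
          + 2 * ∫⁻ ω, ‖(Z k).integral W u ω - I ω‖ₑ ^ 2 ∂P)) atTop (𝓝 (4 * κ m + (4 * 0 + 2 * 0))) :=
      tendsto_const_nhds.add ((ENNReal.Tendsto.const_mul hZ1 (by simp)).add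
        (ENNReal.Tendsto.const_mul hZ2 (by simp)))
    simpa using ge_of_tendsto' h2 h1
  have hlim : ∀ᵐ ω ∂P, Tendsto (fun m => J m ω) atTop
      (𝓝 (φ u * W u ω - ∫ s in (0 : ℝ)..u, deriv φ s * W s ω)) := by
    filter_upwards [hW.cont, hW.zero] with ω hc h0
    have := tendsto_riemannSum hu.1 hφ (hc.mono (Icc_subset_Icc_right hu.2))
    simpa [h0] using this
  have hκ0 : Tendsto (fun m => 4 * κ m) atTop (𝓝 0) := by
    have := ENNReal.Tendsto.const_mul (a := 4) (tendsto_lintegral_stepFn_sub_sq hu.1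
      (φ := φ) hφ.continuous.continuousOn) (by simp)
    simpa using this
  set L : Ω → ℝ := fun ω => φ u * W u ω - ∫ s in (0 : ℝ)..u, deriv φ s * W s ω
  have hLm : AEMeasurable L P :=
    aemeasurable_of_tendsto_metrizable_ae atTop (fun m => (hJm m).aemeasurable) hlim
  -- The Riemann sums tend to `I` in mean square and to `L` pathwise; Fatou's lemma identifies the
  -- two limits.
  have hliminf : ∀ᵐ ω ∂P, liminf (fun m => ‖J m ω - I ω‖ₑ ^ 2) atTop = ‖L ω - I ω‖ₑ ^ 2 := by
    filter_upwards [hlim] with ω h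
    exact (ENNReal.Tendsto.pow (n := 2)
      ((continuous_enorm.tendsto _).comp (h.sub_const (I ω)))).liminf_eq
  have hzero : ∫⁻ ω, ‖L ω - I ω‖ₑ ^ 2 ∂P = 0 := by
    rw [← lintegral_congr_ae hliminf]
    refine le_antisymm ((lintegral_liminf_le' fun m =>
      ((hJm m).aemeasurable.sub hIm).enorm.pow_const 2).trans ?_) bot_le
    refine (liminf_le_liminf (Eventually.of_forall hbound)).trans ?_
    rw [hκ0.liminf_eq]
  filter_upwards [(lintegral_eq_zero_iff' ((hLm.sub hIm).enorm.pow_const 2)).1 hzero] with ω h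
  have h5 := (pow_eq_zero_iff two_ne_zero).1 h
  rw [enorm_eq_zero] at h5
  exact (sub_eq_zero.1 h5).symm

end ItoIntegral

/-! ### Brownian motion as a continuous Gaussian process -/

/-- The point of `[0, T]` closest to `t`. -/
def clamp (T t : ℝ) : ℝ := min (max t 0) T

lemma clamp_mem {T : ℝ} (hT : 0 ≤ T) (t : ℝ) : clamp T t ∈ Icc 0 T :=
  ⟨le_min (le_max_right _ _) hT, min_le_right _ _⟩

lemma clamp_of_mem {T t : ℝ} (ht : t ∈ Icc 0 T) : clamp T t = t := by
  rw [clamp, max_eq_left ht.1, min_eq_left ht.2]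

lemma continuous_clamp (T : ℝ) : Continuous (clamp T) := by
  unfold clamp; fun_prop

/-- `B` has continuous paths everywhere, is constant outside `[0, T]`, and is a Brownian motion
on `[0, T]`. -/
structure IsContinuousBrownian {Ω : Type*} {mΩ : MeasurableSpace Ω} (T : ℝ) (B : ℝ → Ω → ℝ)
    (P : Measure Ω) : Prop where
  meas : ∀ t, Measurable (B t)
  cont : ∀ ω, Continuous fun t => B t ω
  gauss : IsGaussianProcess B P
  mean : ∀ t, ∫ ω, B t ω ∂P = 0
  cov : ∀ s t, cov[B s, B t; P] = min (clamp T s) (clamp T t)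

section

variable {Ω : Type*} {mΩ : MeasurableSpace Ω} {P : Measure Ω} {T : ℝ}
  {𝓕 : Filtration ℝ mΩ} {W : ℝ → Ω → ℝ}

/-- Induction on the largest index: all earlier increments are measurable at the left end of the
last one, which is independent of that σ-algebra. -/
lemma IsBrownianMotionOn.hasIndepIncrements [IsProbabilityMeasure P] (hT : 0 ≤ T)
    (hW : IsBrownianMotionOn T 𝓕 W P) :
    HasIndepIncrements (fun (t : NNReal) => W (min t T)) P := by
  refine HasIndepIncrements.of_nat fun t ht _ => ?_
  set r : ℕ → ℝ := fun i => min (t i) T with hr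
  have hrm : Monotone r := fun i j h => min_le_min_right _ (by exact_mod_cast ht h)
  have hr0 : ∀ i, 0 ≤ r i := fun i => le_min (t i).2 hT
  have hrT : ∀ i, r i ≤ T := fun i => min_le_right _ _
  have hmeas : ∀ i j, i < j → Measurable[𝓕 (r j)] fun ω => W (r (i + 1)) ω - W (r i) ω := by
    intro i j hij
    exact ((hW.adapted _ ⟨hr0 _, hrT _⟩).mono (𝓕.mono (hrm hij)) le_rfl).sub
      ((hW.adapted _ ⟨hr0 _, hrT _⟩).mono (𝓕.mono (hrm hij.le)) le_rfl)
  rw [iIndepFun_iff_measure_inter_preimage_eq_mul]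
  intro S sets hS
  induction S using Finset.induction_on_max with
  | empty => simp
  | insert k S hk ih =>
    have hkS : k ∉ S := fun h => lt_irrefl _ (hk k h)
    rw [Finset.prod_insert hkS, Finset.set_biInter_insert,
      ← ih fun i hi => hS i (Finset.mem_insert_of_mem hi)]
    have hind := hW.indep (r k) (r (k + 1)) (hr0 k) (hrm (Nat.le_succ k)) (hrT _)
    refine (Indep_iff _ _ _).1 hind _ _ ⟨sets k, hS k (Finset.mem_insert_self _ _), rfl⟩ ?_
    refine Finset.measurableSet_biInter _ fun i hi => ?_
    exact hmeas i k (hk i hi) (hS i (Finset.mem_insert_of_mem hi))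

lemma IsBrownianMotionOn.hasLaw [IsProbabilityMeasure P] (hW : IsBrownianMotionOn T 𝓕 W P)
    {t : ℝ} (ht : t ∈ Icc 0 T) : HasLaw (W t) (gaussianReal 0 t.toNNReal) P := by
  have h := hW.hasLaw_sub le_rfl ht.1 ht.2
  rw [sub_zero] at h
  refine h.congr ?_
  filter_upwards [hW.zero] with ω h0
  rw [h0, sub_zero]

lemma IsBrownianMotionOn.covariance_eq [IsProbabilityMeasure P] (hW : IsBrownianMotionOn T 𝓕 W P)
    {s t : ℝ} (hs : s ∈ Icc 0 T) (ht : t ∈ Icc 0 T) : cov[W s, W t; P] = min s t := by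
  wlog hst : s ≤ t generalizing s t
  · rw [covariance_comm, this ht hs (le_of_not_ge hst), min_comm]
  have h1 : W t = W s + fun ω => W t ω - W s ω := by ext; simp
  have hWs := (hW.hasLaw hs).hasGaussianLaw.memLp_two
  rw [h1, covariance_add_right hWs hWs (hW.memLp_sub hs.1 hst ht.2),
    (hW.indepFun_sub hs.1 hst ht.2 (hW.adapted s hs)).covariance_eq_zero hWs
      (hW.memLp_sub hs.1 hst ht.2), covariance_self (hW.measurable hs).aemeasurable,
    (hW.hasLaw hs).variance_eq, variance_id_gaussianReal, add_zero, min_eq_left hst,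
    Real.coe_toNNReal _ hs.1]

/-- A version with every path continuous makes evaluation at a random site measurable. Paths are
frozen outside [0, T] and set to zero on a measurable null set containing all discontinuous ones. -/
lemma IsBrownianMotionOn.exists_isContinuousBrownian [IsProbabilityMeasure P] (hT : 0 ≤ T)
    (hW : IsBrownianMotionOn T 𝓕 W P) :
    ∃ B, IsContinuousBrownian T B P ∧ ∀ᵐ ω ∂P, ∀ t ∈ Icc 0 T, B t ω = W t ω := by
  obtain ⟨N, hN, hNm, hN0⟩ := exists_measurable_superset_of_null (ae_iff.1 hW.cont)
  have hNae : ∀ᵐ ω ∂P, ω ∈ Nᶜ := by rw [ae_iff]; simpa using hN0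
  have hB : ∀ ω ∈ Nᶜ, ∀ t, Nᶜ.indicator (W (clamp T t)) ω = W (clamp T t) ω :=
    fun ω hω t => indicator_of_mem hω _
  refine ⟨fun t => Nᶜ.indicator (W (clamp T t)), ⟨fun t => ?_, fun ω => ?_, ?_, fun t => ?_,
    fun s t => ?_⟩, ?_⟩
  · exact (hW.measurable (clamp_mem hT t)).indicator hNm.compl
  · by_cases hω : ω ∈ N
    · simp only [indicator_of_notMem (show ω ∉ Nᶜ from fun h => h hω)]
      exact continuous_const
    · simp only [hB ω hω]
      have hc : ContinuousOn (fun t => W t ω) (Icc 0 T) := by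
        by_contra h
        exact hω (hN h)
      exact hc.comp_continuous (continuous_clamp T) (clamp_mem hT)
  · have h1 : IsGaussianProcess (fun (t : NNReal) => W (min t T)) P := by
      refine HasIndepIncrements.isGaussianProcess (fun t => ?_) ?_ (hW.hasIndepIncrements hT)
      · exact (hW.hasLaw ⟨le_min t.2 hT, min_le_right _ _⟩).hasGaussianLaw
      · simpa [hT] using hW.zero
    refine (h1.comp_right Real.toNNReal).congr fun t => ?_
    filter_upwards [hNae] with ω hω
    rw [hB ω hω]
    simp [clamp, Real.coe_toNNReal']
  · have h1 : Nᶜ.indicator (W (clamp T t)) =ᵐ[P] W (clamp T t) := by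
      filter_upwards [hNae] with ω hω using hB ω hω t
    rw [integral_congr_ae h1, (hW.hasLaw (clamp_mem hT t)).integral_eq, integral_id_gaussianReal]
  · have h1 : ∀ t, Nᶜ.indicator (W (clamp T t)) =ᵐ[P] W (clamp T t) := fun t => by
      filter_upwards [hNae] with ω hω using hB ω hω t
    have h2 : cov[Nᶜ.indicator (W (clamp T s)), Nᶜ.indicator (W (clamp T t)); P]
        = cov[W (clamp T s), W (clamp T t); P] := by
      rw [covariance, covariance, integral_congr_ae (h1 s), integral_congr_ae (h1 t)]
      refine integral_congr_ae ?_
      filter_upwards [h1 s, h1 t] with ω hs ht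
      rw [hs, ht]
    rw [h2, hW.covariance_eq (clamp_mem hT s) (clamp_mem hT t)]
  · filter_upwards [hNae] with ω hω t ht
    rw [hB ω hω, clamp_of_mem ht]

/-- The law of the Wiener integral of a smooth function vanishing at the end point. -/
lemma IsBrownianMotionOn.hasLaw_integral_deriv_mul [IsProbabilityMeasure P]
    (hW : IsBrownianMotionOn T 𝓕 W P) {u : ℝ} (hu : u ∈ Icc 0 T) {φ : ℝ → ℝ}
    (hφ : ContDiff ℝ 1 φ) (hφu : φ u = 0) :
    P.map (fun ω => - ∫ s in (0 : ℝ)..u, deriv φ s * W s ω)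
      = gaussianReal 0 (∫ s in (0 : ℝ)..u, φ s ^ 2).toNNReal := by
  set J : ℕ → Ω → ℝ := fun m ω => riemannSum u φ (fun t => W t ω) m with hJ
  set L : Ω → ℝ := fun ω => - ∫ s in (0 : ℝ)..u, deriv φ s * W s ω
  have hT : 0 ≤ T := hu.1.trans hu.2
  have hmW : ∀ t ∈ Icc 0 u, Measurable (W t) := fun t ht => hW.measurable ⟨ht.1, ht.2.trans hu.2⟩
  have hJm : ∀ m, Measurable (J m) := fun m => by
    refine Finset.measurable_fun_sum _ fun i _ => Measurable.const_mul ?_ _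
    exact (hmW _ (gridPt_mem hu.1 i.2)).sub (hmW _ (gridPt_mem hu.1 i.2.le))
  have hlim : ∀ᵐ ω ∂P, Tendsto (fun m => J m ω) atTop (𝓝 (L ω)) := by
    filter_upwards [hW.cont, hW.zero] with ω hc h0
    have := tendsto_riemannSum hu.1 hφ (hc.mono (Icc_subset_Icc_right hu.2))
    simpa [h0, hφu] using this
  have hLm : AEMeasurable L P :=
    aemeasurable_of_tendsto_metrizable_ae atTop (fun m => (hJm m).aemeasurable) hlim
  have hΔmem : ∀ m i, i < m + 1 →
      MemLp (fun ω => W (gridPt u m (i + 1)) ω - W (gridPt u m i) ω) 2 P := fun m i hi =>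
    hW.memLp_sub (gridPt_mem hu.1 hi.le).1 (gridPt_mono hu.1 (Nat.le_succ _))
      ((gridPt_mem hu.1 hi).2.trans hu.2)
  have hJ2 : ∀ m, ∫ ω, J m ω ^ 2 ∂P = ∫ s in Icc 0 u, stepFn u φ m s ^ 2 := by
    intro m
    have h := hW.lintegral_riemannSum_sq hu φ m
    simp_rw [enorm_sq_eq_ofReal] at h
    rw [integral_eq_lintegral_of_nonneg_ae (ae_of_all _ fun ω => sq_nonneg _)
      ((hJm m).pow_const 2).aestronglyMeasurable,
      integral_eq_lintegral_of_nonneg_ae (ae_of_all _ fun ω => sq_nonneg _)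
      (measurable_stepFn.pow_const 2).aestronglyMeasurable, h]
  have hJ0 : ∀ m, ∫ ω, J m ω ∂P = 0 := by
    intro m
    simp only [hJ, riemannSum]
    rw [integral_finsetSum _ fun (i : Fin (m + 1)) _ => ((hΔmem m i i.2).integrable (by norm_num)).const_mul _]
    refine Finset.sum_eq_zero fun i _ => ?_
    rw [integral_const_mul, (hW.hasLaw_sub (gridPt_mem hu.1 i.2.le).1
      (gridPt_mono hu.1 (Nat.le_succ _)) ((gridPt_mem hu.1 i.2).2.trans hu.2)).integral_eq,
      integral_id_gaussianReal, mul_zero]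
  have hJg : ∀ m, HasGaussianLaw (J m) P := by
    intro m
    have h1 := (hW.hasIndepIncrements hT) (m + 1)
      (fun i : Fin (m + 1 + 1) => (gridPt u m i).toNNReal)
      (fun i j h => Real.toNNReal_le_toNNReal (gridPt_mono hu.1 h))
    have e : ∀ i ≤ m + 1, min ((gridPt u m i).toNNReal : ℝ) T = gridPt u m i := fun i hi => by
      have := gridPt_mem (m := m) hu.1 hi
      rw [Real.coe_toNNReal _ this.1, min_eq_left (this.2.trans hu.2)]
    have h2 := h1.hasGaussianLaw (fun i => by
      have hi1 : (i : ℕ) ≤ m + 1 := i.2.le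
      have hi2 : (i : ℕ) + 1 ≤ m + 1 := i.2
      simp only [Fin.val_succ, Fin.val_castSucc, e _ hi1, e _ hi2]
      exact (hW.hasLaw_sub (gridPt_mem hu.1 hi1).1 (gridPt_mono hu.1 (Nat.le_succ _))
        ((gridPt_mem hu.1 hi2).2.trans hu.2)).hasGaussianLaw)
    have h3 := h2.map_fun (∑ i : Fin (m + 1), (φ (gridPt u m i)) •
      (ContinuousLinearMap.proj (R := ℝ) (φ := fun _ : Fin (m + 1) => ℝ) i))
    refine h3.congr (ae_of_all _ fun ω => ?_)
    simp only [hJ, riemannSum, sum_apply, smul_apply,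
      ContinuousLinearMap.proj_apply, smul_eq_mul]
    refine Finset.sum_congr rfl fun i _ => ?_
    have hi1 : (i : ℕ) ≤ m + 1 := i.2.le
    have hi2 : (i : ℕ) + 1 ≤ m + 1 := i.2
    simp only [Fin.val_succ, Fin.val_castSucc, e _ hi1, e _ hi2]
  have hv : Tendsto (fun m => ∫ s in Icc 0 u, stepFn u φ m s ^ 2) atTop
      (𝓝 (∫ s in (0 : ℝ)..u, φ s ^ 2)) := by
    rw [intervalIntegral.integral_of_le hu.1, ← integral_Icc_eq_integral_Ioc]
    obtain ⟨C, hC⟩ := (isCompact_Icc (a := (0 : ℝ)) (b := u)).exists_bound_of_continuousOn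
      hφ.continuous.continuousOn
    have hae : ∀ᵐ s ∂volume.restrict (Icc 0 u), s ∈ Ioc 0 u := by
      rw [← restrict_Ioc_eq_restrict_Icc]
      exact ae_restrict_mem measurableSet_Ioc
    refine tendsto_integral_of_dominated_convergence (fun _ => C ^ 2)
      (fun m => (measurable_stepFn.pow_const 2).aestronglyMeasurable) (by fun_prop) (fun m => ?_) ?_
    · filter_upwards [hae] with s hs
      rw [norm_pow]
      exact pow_le_pow_left₀ (norm_nonneg _) (abs_stepFn_le hu.1 hC hs) 2
    · filter_upwards [hae] with s hs
      exact (tendsto_stepFn hu.1 hφ.continuous.continuousOn hs).pow 2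
  -- The Riemann sums are centred Gaussian, with variances converging to ∫ φ². Pathwise convergence
  -- passes to the characteristic functions, which determine the law of the limit.
  have hchar : ∀ m t, charFun (P.map (J m)) t
      = Complex.exp (-((∫ s in Icc 0 u, stepFn u φ m s ^ 2 : ℝ) * t ^ 2 / 2)) := by
    intro m t
    rw [(hJg m).map_eq_gaussianReal, charFun_gaussianReal, hJ0,
      variance_of_integral_eq_zero (hJm m).aemeasurable (hJ0 m), hJ2,
      Real.coe_toNNReal _ (integral_nonneg fun s => sq_nonneg _)]
    congr 1
    simp
  have hβ : 0 ≤ ∫ s in (0 : ℝ)..u, φ s ^ 2 :=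
    intervalIntegral.integral_nonneg hu.1 fun s _ => sq_nonneg _
  have : IsProbabilityMeasure (P.map L) := Measure.isProbabilityMeasure_map hLm
  refine Measure.ext_of_charFun ?_
  ext t
  rw [charFun_gaussianReal, Real.coe_toNNReal _ hβ]
  have h1 : Tendsto (fun m => charFun (P.map (J m)) t) atTop (𝓝 (charFun (P.map L) t)) := by
    have e : ∀ {Y : Ω → ℝ}, AEMeasurable Y P → charFun (P.map Y) t
        = ∫ ω, Complex.exp (t * Y ω * Complex.I) ∂P := fun hY => by
      rw [charFun_apply_real, integral_map hY (by fun_prop)]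
    rw [e hLm]
    simp_rw [e (hJm _).aemeasurable]
    refine tendsto_integral_of_dominated_convergence (fun _ => 1) (fun m => ?_)
      (integrable_const _) (fun m => ae_of_all _ fun ω => ?_) ?_
    · exact (Measurable.aestronglyMeasurable (by have := hJm m; fun_prop))
    · rw [← Complex.ofReal_mul, Complex.norm_exp_ofReal_mul_I]
    · filter_upwards [hlim] with ω h
      have hc : Continuous fun x : ℝ => Complex.exp (t * x * Complex.I) := by fun_prop
      exact (hc.tendsto _).comp h
  simp_rw [hchar] at h1
  refine tendsto_nhds_unique h1 ?_
  have hc : Continuous fun x : ℝ => Complex.exp (-(x * t ^ 2 / 2)) := by fun_prop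
  have := (hc.tendsto _).comp hv
  simpa [Function.comp_def] using this

end

/-! ### The solution of the equation at the final time -/

section Solution

variable {Ω : Type*} {mΩ : MeasurableSpace Ω} {P : Measure Ω} {T τ₁ τ₂ : ℝ}
  {𝓕 : Filtration ℝ mΩ} {W : ℝ → Ω → ℝ} {f g h ψ : ℝ → ℝ} {X : ℝ → Ω → E4}

lemma ae_forall_eq_of_forall_ae_eq {a b : ℝ} {Y Z : ℝ → Ω → ℝ}
    (hY : ∀ᵐ ω ∂P, ContinuousOn (fun t => Y t ω) (Icc a b))
    (hZ : ∀ᵐ ω ∂P, ContinuousOn (fun t => Z t ω) (Icc a b))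
    (hYZ : ∀ t ∈ Icc a b, ∀ᵐ ω ∂P, Y t ω = Z t ω) :
    ∀ᵐ ω ∂P, ∀ t ∈ Icc a b, Y t ω = Z t ω := by
  obtain ⟨s, hsc, hsd⟩ := TopologicalSpace.exists_countable_dense (Icc a b)
  have h1 : ∀ᵐ ω ∂P, ∀ t ∈ s, Y t ω = Z t ω :=
    (ae_ball_iff hsc).2 fun t _ => hYZ t t.2
  filter_upwards [h1, hY, hZ] with ω hω hYω hZω t ht
  have := Continuous.ext_on hsd hYω.domRestrict hZω.domRestrict (fun t ht => hω t ht)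
  exact congrFun this ⟨t, ht⟩

lemma eq_zero_of_support_subset_Iic {φ : ℝ → ℝ} {τ : ℝ} (hφ : Continuous φ)
    (hs : Function.support φ ⊆ Iic τ) {t : ℝ} (ht : τ ≤ t) : φ t = 0 := by
  have h1 : EqOn φ 0 (Ioi τ) := fun x hx => by
    by_contra hne
    exact absurd (mem_Iic.1 (hs hne)) (not_le.2 hx)
  have h2 := h1.closure hφ continuous_const
  rw [closure_Ioi] at h2
  exact h2 ht

lemma deriv_eq_zero_of_support_subset_Iic {φ : ℝ → ℝ} {τ : ℝ} (hφ : ContDiff ℝ 1 φ)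
    (hs : Function.support φ ⊆ Iic τ) {t : ℝ} (ht : τ ≤ t) : deriv φ t = 0 := by
  refine eq_zero_of_support_subset_Iic (hφ.continuous_deriv le_rfl) (fun x hx => ?_) ht
  by_contra hne
  rw [mem_Iic, not_le] at hne
  refine hx (EventuallyEq.deriv_eq (f := fun _ => 0) ?_ |>.trans (by simp))
  filter_upwards [Ioi_mem_nhds hne] with y hy
  exact eq_zero_of_support_subset_Iic hφ.continuous hs (le_of_lt hy)

/-- The first coordinate is a clock. This makes the diffusion coefficients deterministic functions
of time along the solution. -/
lemma IsSDESolution.ae_time [IsProbabilityMeasure P] (hW : IsBrownianMotionOn T 𝓕 W P)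
    (hX : IsSDESolution T 𝓕 P W (driftCoeff h ψ) (diffusionCoeff f g) 0 X) :
    ∀ᵐ ω ∂P, ∀ t ∈ Icc 0 T, X t ω 0 = t := by
  refine ae_forall_eq_of_forall_ae_eq (Z := fun t _ => t) ?_
    (ae_of_all _ fun ω => continuousOn_id) fun u hu => ?_
  · filter_upwards [hX.cont] with ω hω
    exact (EuclideanSpace.proj (𝕜 := ℝ) (0 : Fin 4)).continuous.comp_continuousOn hω
  have hm : Measurable (X u) := (hX.adapted u hu).mono (𝓕.le u) le_rfl
  have h1 := hX.eqn u hu 0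
  have h2 := h1.ae_eq_of_deterministic hW hu (φ := fun _ => 0)
    (by simp only [driftCoeff]; simp; fun_prop) contDiff_const
    (ae_of_all _ fun ω s _ => by simp [diffusionCoeff])
  filter_upwards [h2] with ω hω
  simp [driftCoeff] at hω
  linarith

/-- The components of the solution which are Itô integrals. -/
lemma IsSDESolution.ae_component [IsProbabilityMeasure P] (hW : IsBrownianMotionOn T 𝓕 W P)
    (hX : IsSDESolution T 𝓕 P W (driftCoeff h ψ) (diffusionCoeff f g) 0 X) {i : Fin 4}
    {φ : ℝ → ℝ} (hφ : ContDiff ℝ 1 φ) (hi : ∀ x : E4, driftCoeff h ψ x i = 0)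
    (hφi : ∀ x : E4, diffusionCoeff f g x i = φ (x 0)) {τ : ℝ} (hτ : 0 ≤ τ)
    (hφτ : Function.support φ ⊆ Iic τ) :
    ∀ᵐ ω ∂P, ∀ t ∈ Icc τ T, X t ω i = - ∫ s in (0 : ℝ)..T, deriv φ s * W s ω := by
  refine ae_forall_eq_of_forall_ae_eq
    (Z := fun _ ω => - ∫ s in (0 : ℝ)..T, deriv φ s * W s ω) ?_
    (ae_of_all _ fun ω => continuousOn_const) fun u hu => ?_
  · filter_upwards [hX.cont] with ω hω
    exact (EuclideanSpace.proj (𝕜 := ℝ) i).continuous.comp_continuousOn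
      (hω.mono (Icc_subset_Icc_left hτ))
  have hu0 : u ∈ Icc 0 T := ⟨hτ.trans hu.1, hu.2⟩
  have hm : Measurable (X u) := (hX.adapted u hu0).mono (𝓕.le u) le_rfl
  have h2 := (hX.eqn u hu0 i).ae_eq_of_deterministic hW hu0 (φ := φ)
    (by simp only [hi]; simp; fun_prop) hφ (by
      filter_upwards [hX.ae_time hW] with ω hω s hs
      rw [hφi, hω s ⟨hs.1, hs.2.trans hu.2⟩])
  filter_upwards [h2, hW.cont] with ω hω hc
  simp only [hi, intervalIntegral.integral_zero, sub_zero] at hω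
  simp only [PiLp.zero_apply, sub_zero] at hω
  -- After τ both `φ` and its derivative vanish: the boundary term drops out and the integral may be
  -- extended from u to T.
  rw [hω, eq_zero_of_support_subset_Iic hφ.continuous hφτ hu.1, zero_mul, zero_sub, neg_inj]
  have hcont : ContinuousOn (fun s => deriv φ s * W s ω) (Icc 0 T) :=
    (hφ.continuous_deriv le_rfl).continuousOn.mul hc
  have hint : ∀ a ∈ Icc 0 T, ∀ b ∈ Icc 0 T,
      IntervalIntegrable (fun s => deriv φ s * W s ω) volume a b := fun a ha b hb =>
    (hcont.mono (uIcc_subset_Icc ha hb)).intervalIntegrable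
  have hT0 : 0 ≤ T := hu0.1.trans hu0.2
  rw [← intervalIntegral.integral_add_adjacent_intervals
    (hint 0 ⟨le_rfl, hT0⟩ u hu0) (hint u hu0 T ⟨hT0, le_rfl⟩), left_eq_add]
  refine (intervalIntegral.integral_congr (g := fun _ => 0) fun s hs => ?_).trans (by simp)
  rw [uIcc_of_le hu.2] at hs
  simp [deriv_eq_zero_of_support_subset_Iic hφ hφτ (hu.1.trans hs.1)]

/-- The last component of the solution at the final time. -/
lemma IsSDESolution.ae_final [IsProbabilityMeasure P] (hW : IsBrownianMotionOn T 𝓕 W P)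
    (hS : IsSetting T τ₁ τ₂ f g h)
    (hX : IsSDESolution T 𝓕 P W (driftCoeff h ψ) (diffusionCoeff f g) 0 X)
    (hψ : Continuous ψ) :
    ∀ᵐ ω ∂P, X T ω 3 = gammaConst τ₂ T h *
      Real.cos (ψ (- ∫ s in (0 : ℝ)..T, deriv g s * W s ω)
        * (- ∫ s in (0 : ℝ)..T, deriv f s * W s ω)) := by
  have hf1 : ContDiff ℝ 1 f := hS.f_smooth.of_le (by exact_mod_cast le_top)
  have hg1 : ContDiff ℝ 1 g := hS.g_smooth.of_le (by exact_mod_cast le_top)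
  have hτ₂ : 0 ≤ τ₂ := (hS.τ₁_pos.trans hS.τ₁_lt).le
  have hT : 0 ≤ T := hτ₂.trans hS.τ₂_lt.le
  have hTm : T ∈ Icc 0 T := ⟨hT, le_rfl⟩
  have hm : Measurable (X T) := (hX.adapted T hTm).mono (𝓕.le T) le_rfl
  have h1 := hX.ae_component hW (i := 1) hf1 (fun x => by simp [driftCoeff])
    (fun x => by simp [diffusionCoeff]) hτ₂ (hS.f_supp.trans (Iic_subset_Iic.2 hS.τ₁_lt.le))
  have h2 := hX.ae_component hW (i := 2) hg1 (fun x => by simp [driftCoeff])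
    (fun x => by simp [diffusionCoeff]) hτ₂ (hS.g_supp.trans Icc_subset_Iic_self)
  have hdrift : ∀ᵐ ω ∂P, ∫ s in (0 : ℝ)..T, driftCoeff h ψ (X s ω) 3
      = gammaConst τ₂ T h * Real.cos (ψ (X T ω 2) * X T ω 1) := by
    filter_upwards [hX.ae_time hW, h1, h2] with ω h0 h1 h2
    -- Before τ₂ the factor `h` is zero, and from τ₂ on components 1 and 2 are constant in time, so
    -- the cosine factors out.
    have hcongr : ∫ s in (0 : ℝ)..T, driftCoeff h ψ (X s ω) 3
        = ∫ s in (0 : ℝ)..T, h s * Real.cos (ψ (X T ω 2) * X T ω 1) := by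
      refine intervalIntegral.integral_congr fun s hs => ?_
      rw [uIcc_of_le hT] at hs
      simp only [driftCoeff, h0 s hs]
      change h s * Real.cos (X s ω 1 * ψ (X s ω 2)) = _
      by_cases hsτ : τ₂ ≤ s
      · rw [h1 s ⟨hsτ, hs.2⟩, h2 s ⟨hsτ, hs.2⟩, h1 T ⟨hS.τ₂_lt.le, le_rfl⟩,
          h2 T ⟨hS.τ₂_lt.le, le_rfl⟩, mul_comm (ψ _)]
      · have : h s = 0 := by
          by_contra hne
          exact hsτ (hS.h_supp hne)
        simp [this]
    have hc := hS.h_smooth.continuous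
    rw [hcongr, intervalIntegral.integral_mul_const,
      ← intervalIntegral.integral_add_adjacent_intervals (hc.intervalIntegrable 0 τ₂)
      (hc.intervalIntegrable τ₂ T), gammaConst]
    have hz : ∫ s in (0 : ℝ)..τ₂, h s = 0 := by
      rw [intervalIntegral.integral_of_le hτ₂, ← integral_Ioc_eq_integral_Ioo.symm]
      refine (setIntegral_congr_fun (g := fun _ => 0) measurableSet_Ioo fun s hs => ?_).trans
        (by simp)
      by_contra hne
      exact absurd (hS.h_supp hne) (not_le.2 hs.2)
    rw [hz, zero_add]
  have hIm : AEMeasurable (fun ω => X T ω 3 - (0 : E4) 3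
      - ∫ s in (0 : ℝ)..T, driftCoeff h ψ (X s ω) 3) P := by
    have hm2 : Measurable fun ω => X T ω 3 - (0 : E4) 3
        - gammaConst τ₂ T h * Real.cos (ψ (X T ω 2) * X T ω 1) := by
      have := hψ.measurable
      fun_prop
    refine hm2.aemeasurable.congr ?_
    filter_upwards [hdrift] with ω hω
    rw [hω]
  have h3 := (hX.eqn T hTm 3).ae_eq_of_deterministic hW hTm (φ := fun _ => 0) hIm contDiff_const
    (ae_of_all _ fun ω s _ => by simp [diffusionCoeff])
  filter_upwards [h3, hdrift, h1, h2] with ω h3 hd h1 h2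
  rw [hd, h1 T ⟨hS.τ₂_lt.le, le_rfl⟩, h2 T ⟨hS.τ₂_lt.le, le_rfl⟩] at h3
  simp at h3
  rw [sub_eq_zero.1 h3]
  simp

end Solution

/-! ### Adaptive methods along paths -/

namespace AdaptiveMethod

variable {δ T : ℝ} (M : AdaptiveMethod δ T)

/-- The evaluation site number `i + 1` for the path `w`. -/
def siteAt (w : ℝ → ℝ) (i : ℕ) : ℝ := M.site i (M.data w i)

/-- The method stops for the path `w` after exactly `k + 1` evaluations. -/
def StopsAt (k : ℕ) (w : ℝ → ℝ) : Prop :=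
  M.halt k (M.data w (k + 1)) = true ∧ ∀ i < k, ¬ M.halt i (M.data w (i + 1)) = true

lemma data_zero (w : ℝ → ℝ) : M.data w 0 = (Fin.elim0, fun t : Icc δ T => w t) := rfl

lemma data_succ (w : ℝ → ℝ) (n : ℕ) :
    M.data w (n + 1) = (Fin.snoc (M.data w n).1 (w (M.siteAt w n)), fun t : Icc δ T => w t) := rfl

/-- Each site is a function of the earlier data, so agreement at the sites chosen for `w` alone
forces the same sites for `w'`. -/
lemma data_congr {w w' : ℝ → ℝ} (h : ∀ t ∈ Icc δ T, w t = w' t) {k : ℕ}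
    (hk : ∀ i < k, w (M.siteAt w i) = w' (M.siteAt w i)) : ∀ i ≤ k, M.data w i = M.data w' i := by
  intro i hi
  have h2 : (fun t : Icc δ T => w t) = fun t : Icc δ T => w' t := funext fun t => h t t.2
  induction i with
  | zero => rw [data_zero, data_zero, h2]
  | succ i ih =>
    have hd := ih (by omega)
    have hs : M.siteAt w i = M.siteAt w' i := by rw [siteAt, siteAt, hd]
    rw [data_succ, data_succ, h2, hd, hk i (by omega), hs]

lemma stopsAt_congr {w w' : ℝ → ℝ} {k : ℕ} (h : ∀ i ≤ k + 1, M.data w i = M.data w' i) :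
    M.StopsAt k w ↔ M.StopsAt k w' := by
  rw [StopsAt, StopsAt, h (k + 1) le_rfl]
  refine and_congr_right fun _ => forall₂_congr fun i hi => ?_
  rw [h (i + 1) (by omega)]

lemma StopsAt.unique {M : AdaptiveMethod δ T} {w : ℝ → ℝ} {k l : ℕ} (hk : M.StopsAt k w)
    (hl : M.StopsAt l w) : k = l := by
  rcases lt_trichotomy k l with h | h | h
  · exact absurd hk.1 (hl.2 k h)
  · exact h
  · exact absurd hl.1 (hk.2 l h)

open Classical in
lemma StopsAt.output_eq {M : AdaptiveMethod δ T} {w : ℝ → ℝ} {k : ℕ} (hk : M.StopsAt k w) :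
    M.output w = M.estimate k (M.data w (k + 1)) := by
  have hs : M.Stops w := ⟨k, hk.1⟩
  have hf : Nat.find hs = k := (Nat.find_eq_iff hs).2 hk
  rw [output, dif_pos hs, hf]

open Classical in
lemma le_numEval {w : ℝ → ℝ} {n : ℕ} (h : ∀ k < n, ¬ M.StopsAt k w) : (n : ℕ∞) ≤ M.numEval w := by
  rw [numEval]
  split_ifs with hs
  · have : n ≤ Nat.find hs := by
      by_contra hlt
      exact h _ (not_le.1 hlt) ⟨Nat.find_spec hs, fun i hi => Nat.find_min hs hi⟩
    exact_mod_cast this.trans (Nat.le_succ _)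
  · exact le_top

lemma siteAt_congr {w w' : ℝ → ℝ} {i : ℕ} (h : M.data w i = M.data w' i) :
    M.siteAt w i = M.siteAt w' i := by rw [siteAt, siteAt, h]

/-- Paths which agree on `(0, T]` are not distinguished by the method. -/
lemma data_congr_of_eqOn {w w' : ℝ → ℝ} (hδ : δ ∈ Ioc 0 T) (h : ∀ t ∈ Icc 0 T, w t = w' t)
    (i : ℕ) : M.data w i = M.data w' i :=
  M.data_congr (fun t ht => h t ⟨hδ.1.le.trans ht.1, ht.2⟩)
    (fun _ _ => h _ ⟨(M.site_mem _ _).1.le, ((M.site_mem _ _).2.le.trans hδ.2)⟩) i le_rfl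

section Measurability

variable {Ω : Type*} [MeasurableSpace Ω] {Y : ℝ → Ω → ℝ}

/-- The sites are random; continuity of the paths gives the joint measurability needed to evaluate
there. -/
lemma measurable_data (hY : ∀ t, Measurable (Y t)) (hYc : ∀ ω, Continuous fun t => Y t ω)
    (n : ℕ) : Measurable fun ω => M.data (fun t => Y t ω) n := by
  have hv : Measurable fun ω => fun t : Icc δ T => Y t ω :=
    measurable_pi_iff.2 fun t => hY t
  induction n with
  | zero => exact measurable_const.prodMk hv
  | succ n ih =>
    have hsite : Measurable fun ω => M.siteAt (fun t => Y t ω) n := (M.site_meas n).comp ih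
    have hval : Measurable fun ω => Y (M.siteAt (fun t => Y t ω) n) ω :=
      (measurable_uncurry_of_continuous_of_measurable hYc hY).comp (hsite.prodMk measurable_id)
    refine Measurable.prodMk (measurable_pi_iff.2 fun i => ?_) hv
    refine Fin.lastCases ?_ (fun j => ?_) i
    · simpa [obs, siteAt, data] using hval
    · have := measurable_pi_iff.1 (measurable_fst.comp ih) j
      simpa [obs, data] using this

lemma measurable_siteAt (hY : ∀ t, Measurable (Y t)) (hYc : ∀ ω, Continuous fun t => Y t ω)
    (n : ℕ) : Measurable fun ω => M.siteAt (fun t => Y t ω) n :=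
  (M.site_meas n).comp (M.measurable_data hY hYc n)

lemma measurableSet_stopsAt (hY : ∀ t, Measurable (Y t)) (hYc : ∀ ω, Continuous fun t => Y t ω)
    (k : ℕ) : MeasurableSet {ω | M.StopsAt k fun t => Y t ω} := by
  have h : ∀ i, MeasurableSet {ω | M.halt i (M.data (fun t => Y t ω) (i + 1)) = true} := fun i =>
    ((M.halt_meas i).comp (M.measurable_data hY hYc (i + 1))) (measurableSet_singleton true)
  have e : {ω | M.StopsAt k fun t => Y t ω}
      = {ω | M.halt k (M.data (fun t => Y t ω) (k + 1)) = true}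
        ∩ ⋂ i, ⋂ (_ : i < k), {ω | M.halt i (M.data (fun t => Y t ω) (i + 1)) = true}ᶜ := by
    ext ω
    simp [StopsAt]
  rw [e]
  exact (h k).inter (MeasurableSet.iInter fun i => MeasurableSet.iInter fun _ => (h i).compl)

end Measurability

/-- The intervals `(j d, (j + 1) d)`, `j < L`, hit by the first `k + 1` evaluation sites. -/
noncomputable def touched (d : ℝ) (L k : ℕ) (w : ℝ → ℝ) : Finset ℕ := by
  classical
  exact (Finset.range L).filter fun j => ∃ i ≤ k, M.siteAt w i ∈ Ioo (j * d) ((j + 1) * d)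

lemma mem_touched {d : ℝ} {L k : ℕ} {w : ℝ → ℝ} {j : ℕ} : j ∈ M.touched d L k w ↔
    j < L ∧ ∃ i ≤ k, M.siteAt w i ∈ Ioo (j * d) ((j + 1) * d) := by
  classical
  simp [touched]

lemma touched_subset {d : ℝ} {L k : ℕ} {w : ℝ → ℝ} : M.touched d L k w ⊆ Finset.range L :=
  fun _ hj => Finset.mem_range.2 (M.mem_touched.1 hj).1

lemma touched_congr {d : ℝ} {L k : ℕ} {w w' : ℝ → ℝ} (h : ∀ i ≤ k, M.data w i = M.data w' i) :
    M.touched d L k w = M.touched d L k w' := by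
  ext j
  rw [mem_touched, mem_touched]
  refine and_congr_right fun _ => exists_congr fun i => and_congr_right fun hi => ?_
  rw [M.siteAt_congr (h i hi)]

/-- The intervals are disjoint: a site t can only hit the one with index ⌊t / d⌋. -/
lemma card_touched_le {d : ℝ} (hd : 0 < d) {L k : ℕ} {w : ℝ → ℝ} :
    (M.touched d L k w).card ≤ k + 1 := by
  have hsub : M.touched d L k w
      ⊆ (Finset.range (k + 1)).image fun i => ⌊M.siteAt w i / d⌋₊ := by
    intro j hj
    obtain ⟨-, i, hi, h1, h2⟩ := M.mem_touched.1 hj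
    refine Finset.mem_image.2 ⟨i, Finset.mem_range.2 (by omega), ?_⟩
    have h3 : (j : ℝ) ≤ M.siteAt w i / d := by rw [le_div_iff₀ hd]; exact h1.le
    rw [Nat.floor_eq_iff (le_trans (Nat.cast_nonneg j) h3)]
    exact ⟨h3, by rw [div_lt_iff₀ hd]; exact h2⟩
  exact (Finset.card_le_card hsub).trans (Finset.card_image_le.trans (by simp))

lemma measurableSet_touched_eq {Ω : Type*} [MeasurableSpace Ω] {Y : ℝ → Ω → ℝ}
    (hY : ∀ t, Measurable (Y t)) (hYc : ∀ ω, Continuous fun t => Y t ω) (d : ℝ) (L k : ℕ)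
    (S : Finset ℕ) : MeasurableSet {ω | M.touched d L k (fun t => Y t ω) = S} := by
  have h : ∀ j, MeasurableSet {ω | j ∈ M.touched d L k fun t => Y t ω} := by
    intro j
    have e : {ω | j ∈ M.touched d L k fun t => Y t ω} = ⋃ i, ⋃ (_ : j < L ∧ i ≤ k),
        {ω | M.siteAt (fun t => Y t ω) i ∈ Ioo (j * d) ((j + 1) * d)} := by
      ext ω
      simp only [mem_ofPred_eq, mem_touched, mem_iUnion, exists_prop, and_assoc, exists_and_left]
    rw [e]
    exact MeasurableSet.iUnion fun i => MeasurableSet.iUnion fun _ =>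
      M.measurable_siteAt hY hYc i measurableSet_Ioo
  have e : {ω | M.touched d L k (fun t => Y t ω) = S}
      = ⋂ j, {ω | j ∈ M.touched d L k (fun t => Y t ω) ↔ j ∈ S} := by
    ext ω; simp [Finset.ext_iff]
  rw [e]
  refine MeasurableSet.iInter fun j => ?_
  by_cases hj : j ∈ S
  · simpa [hj] using h j
  · convert (h j).compl using 1
    ext ω; simp [hj]

/-- If two paths differ only on intervals not hit for the first path, they lead to the
same data. -/
lemma data_congr_of_touched_eq {d : ℝ} {L k : ℕ} {w w' : ℝ → ℝ}
    (h : ∀ t ∈ Icc δ T, w t = w' t)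
    (h' : ∀ t, (∀ j < L, j ∉ M.touched d L k w → t ∉ Ioo (j * d) ((j + 1) * d)) → w t = w' t) :
    ∀ i ≤ k + 1, M.data w i = M.data w' i := by
  refine M.data_congr h fun i hi => h' _ fun j hj hjt hmem => hjt ?_
  exact M.mem_touched.2 ⟨hj, i, by omega, hmem⟩

/-- The paths are compared outside a fixed `S` instead of the random hit set, which makes the
hypotheses symmetric in `w` and `w'`. This transfers the event to the modified path. -/
lemma stopsAt_and_touched_iff {d : ℝ} {L k : ℕ} {S : Finset ℕ} {w w' : ℝ → ℝ}
    (h : ∀ t ∈ Icc δ T, w t = w' t)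
    (h' : ∀ t, (∀ j < L, j ∉ S → t ∉ Ioo (j * d) ((j + 1) * d)) → w t = w' t) :
    (M.StopsAt k w ∧ M.touched d L k w = S) ↔ (M.StopsAt k w' ∧ M.touched d L k w' = S) := by
  constructor
  · rintro ⟨hs, rfl⟩
    have hd := M.data_congr_of_touched_eq h h'
    exact ⟨(M.stopsAt_congr hd).1 hs, (M.touched_congr fun i hi => hd i (by omega)).symm⟩
  · rintro ⟨hs, rfl⟩
    have hd := M.data_congr_of_touched_eq (fun t ht => (h t ht).symm)
      (fun t ht => (h' t ht).symm)
    exact ⟨(M.stopsAt_congr hd).1 hs, (M.touched_congr fun i hi => hd i (by omega)).symm⟩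

end AdaptiveMethod

/-! ### Tent functions and the removal of midpoint displacements -/

/-- The tent function of height `d / 4` over the interval `[j d, (j + 1) d]`. -/
noncomputable def tent (d : ℝ) (j : ℕ) (t : ℝ) : ℝ :=
  min ((j + 1 / 2) * d) t - (min (j * d) t + min ((j + 1) * d) t) / 2

/-- The displacement of the path `w` at the midpoint of `[j d, (j + 1) d]` from its linear
interpolation. -/
noncomputable def midDisp (d : ℝ) (j : ℕ) (w : ℝ → ℝ) : ℝ :=
  w ((j + 1 / 2) * d) - (w (j * d) + w ((j + 1) * d)) / 2

/-- The path `w` with the midpoint displacements on the intervals with index in `R` removed. -/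
noncomputable def removeDisp (d : ℝ) (R : Finset ℕ) (w : ℝ → ℝ) (t : ℝ) : ℝ :=
  w t - ∑ j ∈ R, 4 / d * tent d j t * midDisp d j w

section Tent

variable {d : ℝ} {j k : ℕ} {t : ℝ}

lemma continuous_tent : Continuous (tent d j) := by unfold tent; fun_prop

lemma grid_lt_mid (hd : 0 < d) (j : ℕ) : (j : ℝ) * d < (j + 1 / 2) * d := by nlinarith

lemma mid_lt_grid (hd : 0 < d) (j : ℕ) : ((j : ℝ) + 1 / 2) * d < (j + 1) * d := by nlinarith

lemma tent_of_le (hd : 0 < d) (h : t ≤ j * d) : tent d j t = 0 := by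
  have h1 := grid_lt_mid hd j
  have h2 := mid_lt_grid hd j
  rw [tent, min_eq_right h, min_eq_right (by linarith), min_eq_right (by linarith)]
  ring

lemma tent_of_ge (hd : 0 < d) (h : (j + 1) * d ≤ t) : tent d j t = 0 := by
  have h1 := grid_lt_mid hd j
  have h2 := mid_lt_grid hd j
  rw [tent, min_eq_left h, min_eq_left (by linarith), min_eq_left (by linarith)]
  ring

lemma tent_of_mem_left (hd : 0 < d) (h : t ∈ Icc (j * d) ((j + 1 / 2) * d)) :
    tent d j t = (t - j * d) / 2 := by
  have h2 := mid_lt_grid hd j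
  rw [tent, min_eq_right h.2, min_eq_left h.1, min_eq_right (by linarith [h.2])]
  ring

lemma tent_of_mem_right (hd : 0 < d) (h : t ∈ Icc ((j + 1 / 2) * d) ((j + 1) * d)) :
    tent d j t = ((j + 1) * d - t) / 2 := by
  have h1 := grid_lt_mid hd j
  rw [tent, min_eq_left h.1, min_eq_left (by linarith [h.1]), min_eq_right h.2]
  ring

lemma tent_nonneg (hd : 0 < d) (j : ℕ) (t : ℝ) : 0 ≤ tent d j t := by
  rcases le_or_gt t (j * d) with h | h
  · exact (tent_of_le hd h).ge
  rcases le_or_gt ((j + 1) * d) t with h' | h'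
  · exact (tent_of_ge hd h').ge
  rcases le_total t ((j + 1 / 2) * d) with h'' | h''
  · rw [tent_of_mem_left hd ⟨h.le, h''⟩]; linarith
  · rw [tent_of_mem_right hd ⟨h'', h'.le⟩]; linarith

lemma tent_eq_zero_of_notMem (hd : 0 < d) (h : t ∉ Ioo (j * d) ((j + 1) * d)) :
    tent d j t = 0 := by
  rw [mem_Ioo, not_and_or, not_lt, not_lt] at h
  exact h.elim (tent_of_le hd) (tent_of_ge hd)

lemma integral_tent (hd : 0 < d) (j : ℕ) :
    ∫ t in (j * d : ℝ)..((j + 1) * d), tent d j t = d ^ 2 / 8 := by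
  have hi : ∀ a b, IntervalIntegrable (tent d j) volume a b := fun a b =>
    continuous_tent.intervalIntegrable a b
  rw [← intervalIntegral.integral_add_adjacent_intervals (hi _ ((j + 1 / 2) * d)) (hi _ _)]
  have h1 : ∫ t in (j * d : ℝ)..((j + 1 / 2) * d), tent d j t
      = ∫ t in (j * d : ℝ)..((j + 1 / 2) * d), (t - j * d) / 2 :=
    intervalIntegral.integral_congr fun t ht => by
      rw [uIcc_of_le (grid_lt_mid hd j).le] at ht
      exact tent_of_mem_left hd ht
  have h2 : ∫ t in ((j + 1 / 2) * d : ℝ)..((j + 1) * d), tent d j t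
      = ∫ t in ((j + 1 / 2) * d : ℝ)..((j + 1) * d), ((j + 1) * d - t) / 2 :=
    intervalIntegral.integral_congr fun t ht => by
      rw [uIcc_of_le (mid_lt_grid hd j).le] at ht
      exact tent_of_mem_right hd ht
  rw [h1, h2]
  simp only [intervalIntegral.integral_div]
  rw [intervalIntegral.integral_sub (Continuous.intervalIntegrable (by fun_prop) _ _) (Continuous.intervalIntegrable (by fun_prop) _ _),
    intervalIntegral.integral_sub (Continuous.intervalIntegrable (by fun_prop) _ _) (Continuous.intervalIntegrable (by fun_prop) _ _)]
  simp only [integral_id, intervalIntegral.integral_const, smul_eq_mul]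
  ring

/-- The tents and the midpoint functionals are biorthogonal up to d / 4, which explains the factor 4
/ d in `removeDisp`. -/
lemma midDisp_tent (hd : 0 < d) (j k : ℕ) :
    midDisp d k (tent d j) = if k = j then d / 4 else 0 := by
  have h1 := grid_lt_mid hd k
  have h2 := mid_lt_grid hd k
  split_ifs with h
  · subst h
    rw [midDisp, tent_of_le hd le_rfl, tent_of_ge hd le_rfl, tent_of_mem_left hd ⟨h1.le, le_rfl⟩]
    ring
  rcases lt_or_gt_of_ne h with h | h
  · have h3 : ((k : ℝ) + 1) * d ≤ j * d := by
      have : ((k : ℝ) + 1) ≤ j := by exact_mod_cast h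
      gcongr
    rw [midDisp, tent_of_le hd h3, tent_of_le hd (by linarith), tent_of_le hd (by linarith)]
    ring
  · have h3 : ((j : ℝ) + 1) * d ≤ k * d := by
      have : ((j : ℝ) + 1) ≤ k := by exact_mod_cast h
      gcongr
    rw [midDisp, tent_of_ge hd h3, tent_of_ge hd (by linarith), tent_of_ge hd (by linarith)]
    ring

lemma removeDisp_eq_self (hd : 0 < d) {R : Finset ℕ} (w : ℝ → ℝ)
    (h : ∀ j ∈ R, t ∉ Ioo (j * d) ((j + 1) * d)) : removeDisp d R w t = w t := by
  rw [removeDisp, Finset.sum_eq_zero, sub_zero]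
  intro j hj
  rw [tent_eq_zero_of_notMem hd (h j hj)]
  ring

/-- The integral of a tent against a function bounded away from zero on an interval. -/
lemma abs_integral_mul_tent_ge (hd : 0 < d) {F : ℝ → ℝ} (hF : Continuous F) {U V r : ℝ}
    (hjU : (j + 1) * d ≤ V) (hVU : V ≤ U) (hr : 0 < r) (hrF : ∀ t ∈ Icc 0 V, r ≤ |F t|) :
    r * (d ^ 2 / 8) ≤ |∫ t in (0 : ℝ)..U, F t * tent d j t| := by
  have hjd : (0 : ℝ) ≤ j * d := by positivity
  have hlt : (j : ℝ) * d ≤ (j + 1) * d := by nlinarith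
  wlog hF0 : 0 < F 0 generalizing F
  · have hV : 0 ≤ V := by nlinarith
    have h0 : F 0 ≠ 0 := fun h => by
      have := hrF 0 ⟨le_rfl, hV⟩
      rw [h, abs_zero] at this
      linarith
    have := this (F := fun t => - F t) hF.neg (by simpa using hrF)
      (by have := lt_of_le_of_ne (not_lt.1 hF0) h0; linarith)
    simpa using this
  -- A continuous function with |F| ≥ r > 0 cannot change sign, so no cancellation occurs in the
  -- integral.
  have hpos : ∀ t ∈ Icc 0 V, r ≤ F t := by
    intro t ht
    rcases le_or_gt (F t) 0 with h | h
    · obtain ⟨s, hs, hs0⟩ := intermediate_value_Icc' ht.1 hF.continuousOn ⟨h, hF0.le⟩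
      have := hrF s ⟨hs.1, hs.2.trans ht.2⟩
      rw [hs0, abs_zero] at this
      linarith
    · have := hrF t ht
      rwa [abs_of_pos h] at this
  have hc : Continuous fun t => F t * tent d j t := hF.mul continuous_tent
  have hi : ∀ a b, IntervalIntegrable (fun t => F t * tent d j t) volume a b := fun a b =>
    hc.intervalIntegrable a b
  have h1 : ∫ t in (0 : ℝ)..(j * d), F t * tent d j t = 0 := by
    refine (intervalIntegral.integral_congr (g := fun _ => 0) fun t ht => ?_).trans (by simp)
    rw [uIcc_of_le hjd] at ht
    simp [tent_of_le hd ht.2]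
  have h2 : ∫ t in ((j + 1) * d : ℝ)..U, F t * tent d j t = 0 := by
    refine (intervalIntegral.integral_congr (g := fun _ => 0) fun t ht => ?_).trans (by simp)
    rw [uIcc_of_le (hjU.trans hVU)] at ht
    simp [tent_of_ge hd ht.1]
  rw [← intervalIntegral.integral_add_adjacent_intervals (hi 0 (j * d)) (hi _ U),
    ← intervalIntegral.integral_add_adjacent_intervals (hi (j * d) ((j + 1) * d)) (hi _ U),
    h1, h2, zero_add, add_zero, ← integral_tent hd j, ← intervalIntegral.integral_const_mul]
  refine le_trans ?_ (le_abs_self _)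
  refine intervalIntegral.integral_mono_on hlt
    ((continuous_const.mul continuous_tent).intervalIntegrable _ _) (hi _ _) fun t ht => ?_
  exact mul_le_mul_of_nonneg_right (hpos t ⟨hjd.trans ht.1, ht.2.trans hjU⟩) (tent_nonneg hd j t)

end Tent

/-! ### Gaussian law and independence of midpoint displacements -/

section GaussianSpan

variable {Ω ι κ : Type*} {mΩ : MeasurableSpace Ω} {P : Measure Ω}

/-- Linear combinations of a Gaussian process form a Gaussian process. -/
lemma isGaussianProcess_of_mem_span {X : ι → Ω → ℝ} (hX : IsGaussianProcess X P)
    {Y : κ → Ω → ℝ} (hY : ∀ k, Y k ∈ Submodule.span ℝ (range X)) : IsGaussianProcess Y P := by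
  refine hX.of_isGaussianProcess fun k => ?_
  obtain ⟨c, hc⟩ := (Finsupp.mem_span_range_iff_exists_finsupp).1 (hY k)
  refine ⟨c.support, ∑ i : c.support, c i •
    ContinuousLinearMap.proj (R := ℝ) (φ := fun _ : c.support => ℝ) i, fun ω => ?_⟩
  rw [← hc, Finsupp.sum, Finset.sum_apply, ← Finset.sum_coe_sort]
  simp

end GaussianSpan

section Displacement

variable {Ω : Type*} {mΩ : MeasurableSpace Ω} {P : Measure Ω} {T d : ℝ} {B : ℝ → Ω → ℝ}

lemma IsContinuousBrownian.memLp (hB : IsContinuousBrownian T B P) (t : ℝ) : MemLp (B t) 2 P :=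
  (hB.gauss.hasGaussianLaw_eval t).memLp_two

lemma IsContinuousBrownian.memLp_midDisp (hB : IsContinuousBrownian T B P) (j : ℕ) :
    MemLp (fun ω => midDisp d j fun t => B t ω) 2 P := by
  have h : (fun ω => midDisp d j fun t => B t ω) = B ((j + 1 / 2) * d)
      - (1 / 2 : ℝ) • (B (j * d) + B ((j + 1) * d)) := by
    ext ω; simp [midDisp]; ring
  rw [h]
  exact (hB.memLp _).sub (((hB.memLp _).add (hB.memLp _)).const_smul _)

lemma midDisp_mem_span (B : ℝ → Ω → ℝ) (d : ℝ) (j : ℕ) :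
    (fun ω => midDisp d j fun t => B t ω) ∈ Submodule.span ℝ (range B) := by
  have h : (fun ω => midDisp d j fun t => B t ω) = B ((j + 1 / 2) * d)
      - (1 / 2 : ℝ) • (B (j * d) + B ((j + 1) * d)) := by
    ext ω; simp [midDisp]; ring
  have hm : ∀ t, B t ∈ Submodule.span ℝ (range B) := fun t => Submodule.subset_span ⟨t, rfl⟩
  rw [h]
  exact Submodule.sub_mem _ (hm _) (Submodule.smul_mem _ _ (Submodule.add_mem _ (hm _) (hm _)))

lemma IsContinuousBrownian.covariance_midDisp_left [IsProbabilityMeasure P]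
    (hB : IsContinuousBrownian T B P) {Y : Ω → ℝ} (hY : MemLp Y 2 P) (j : ℕ) :
    cov[fun ω => midDisp d j fun t => B t ω, Y; P] = midDisp d j fun t => cov[B t, Y; P] := by
  have h : (fun ω => midDisp d j fun t => B t ω) = B ((j + 1 / 2) * d)
      - (1 / 2 : ℝ) • (B (j * d) + B ((j + 1) * d)) := by
    ext ω; simp [midDisp]; ring
  rw [h, covariance_sub_left (hB.memLp _) (((hB.memLp _).add (hB.memLp _)).const_smul _) hY,
    covariance_smul_left, covariance_add_left (hB.memLp _) (hB.memLp _) hY, midDisp]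
  ring

/-- The covariance is min(s, t), so the midpoint functional acts on s ↦ min(s, t) and yields the
tent; `tent` is written with minima for this reason. -/
lemma IsContinuousBrownian.covariance_midDisp_eval [IsProbabilityMeasure P]
    (hB : IsContinuousBrownian T B P) (hd : 0 < d) {j : ℕ} (hj : (j + 1) * d ≤ T) (t : ℝ) :
    cov[fun ω => midDisp d j fun t => B t ω, B t; P] = tent d j t := by
  have h1 := grid_lt_mid hd j
  have h2 := mid_lt_grid hd j
  have h0 : (0 : ℝ) ≤ j * d := by positivity
  rw [hB.covariance_midDisp_left (hB.memLp t)]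
  simp only [hB.cov, midDisp]
  rw [clamp_of_mem ⟨h0, by linarith⟩, clamp_of_mem (t := (j + 1) * d) ⟨by linarith, hj⟩,
    clamp_of_mem (t := (j + 1 / 2) * d) ⟨by linarith, by linarith⟩]
  rcases le_total t 0 with ht | ht
  · rw [tent_of_le hd (ht.trans h0), clamp, max_eq_right ht,
      min_eq_left (a := (0 : ℝ)) (b := T) (by linarith), min_eq_right h0,
      min_eq_right (by linarith), min_eq_right (by linarith)]
    ring
  · rw [clamp, max_eq_left ht, min_comm t T, ← min_assoc, ← min_assoc, ← min_assoc,
      min_eq_left (a := (j * d : ℝ)) (by linarith),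
      min_eq_left (a := ((j + 1) * d : ℝ)) (by linarith),
      min_eq_left (a := ((j + 1 / 2) * d : ℝ)) (by linarith), tent]

lemma IsContinuousBrownian.covariance_midDisp_midDisp [IsProbabilityMeasure P]
    (hB : IsContinuousBrownian T B P) (hd : 0 < d) {j : ℕ} (hj : (j + 1) * d ≤ T) (k : ℕ) :
    cov[fun ω => midDisp d k fun t => B t ω, fun ω => midDisp d j fun t => B t ω; P]
      = if k = j then d / 4 else 0 := by
  rw [hB.covariance_midDisp_left (hB.memLp_midDisp j), ← midDisp_tent hd]
  congr 1
  ext t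
  rw [covariance_comm, hB.covariance_midDisp_eval hd hj]

lemma IsContinuousBrownian.integral_midDisp (hB : IsContinuousBrownian T B P)
    [IsProbabilityMeasure P] (j : ℕ) : ∫ ω, midDisp d j (fun t => B t ω) ∂P = 0 := by
  have hi : ∀ t, Integrable (B t) P := fun t => (hB.memLp t).integrable (by norm_num)
  simp only [midDisp]
  have h2 : Integrable (fun ω => (B (j * d) ω + B ((j + 1) * d) ω) / 2) P :=
    ((hi _).add (hi _)).div_const 2
  rw [integral_sub (hi _) h2, integral_div, integral_add (hi _) (hi _)]
  simp [hB.mean]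

lemma IsContinuousBrownian.measurable_midDisp (hB : IsContinuousBrownian T B P) (j : ℕ) :
    Measurable fun ω => midDisp d j fun t => B t ω := by
  have := hB.meas
  unfold midDisp
  fun_prop

/-- A linear combination of midpoint displacements is Gaussian. -/
lemma IsContinuousBrownian.map_sum_midDisp [IsProbabilityMeasure P]
    (hB : IsContinuousBrownian T B P) (hd : 0 < d) {R : Finset ℕ}
    (hR : ∀ j ∈ R, ((j : ℝ) + 1) * d ≤ T) (q : ℕ → ℝ) :
    P.map (fun ω => ∑ j ∈ R, q j * midDisp d j fun t => B t ω)
      = gaussianReal 0 (∑ j ∈ R, q j ^ 2 * (d / 4)).toNNReal := by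
  have hm : ∀ j, MemLp (fun ω => q j * midDisp d j fun t => B t ω) 2 P := fun j =>
    (hB.memLp_midDisp j).const_mul (q j)
  have hspan : (fun ω => ∑ j ∈ R, q j * midDisp d j fun t => B t ω)
      ∈ Submodule.span ℝ (range B) := by
    have : (fun ω => ∑ j ∈ R, q j * midDisp d j fun t => B t ω)
        = ∑ j ∈ R, q j • fun ω => midDisp d j fun t => B t ω := by
      ext ω; simp
    rw [this]
    exact Submodule.sum_mem _ fun j _ => Submodule.smul_mem _ _ (midDisp_mem_span B d j)
  have hg := (isGaussianProcess_of_mem_span hB.gauss (κ := Unit)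
    (Y := fun _ => fun ω => ∑ j ∈ R, q j * midDisp d j fun t => B t ω)
    (fun _ => hspan)).hasGaussianLaw_eval ()
  rw [hg.map_eq_gaussianReal]
  congr 1
  · rw [integral_finsetSum _ fun j _ => (hm j).integrable (by norm_num)]
    refine Finset.sum_eq_zero fun j _ => ?_
    rw [integral_const_mul, hB.integral_midDisp, mul_zero]
  · congr 1
    rw [← covariance_self hg.aemeasurable,
      covariance_fun_sum_left' (fun j _ => hm j) (memLp_finsetSum _ fun j _ => hm j)]
    refine Finset.sum_congr rfl fun j hj => ?_
    rw [covariance_fun_sum_right' (fun j _ => hm j) (hm j), Finset.sum_eq_single_of_mem j hj]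
    · rw [covariance_const_mul_left, covariance_const_mul_right,
        hB.covariance_midDisp_midDisp hd (hR j hj), if_pos rfl]
      ring
    · intro k hk hkj
      rw [covariance_const_mul_left, covariance_const_mul_right,
        hB.covariance_midDisp_midDisp hd (hR k hk), if_neg (Ne.symm hkj)]
      ring

/-- The path without midpoint displacements is independent of these displacements. -/
lemma IsContinuousBrownian.indep_removeDisp [IsProbabilityMeasure P]
    (hB : IsContinuousBrownian T B P) (hd : 0 < d) {R : Finset ℕ}
    (hR : ∀ j ∈ R, ((j : ℝ) + 1) * d ≤ T) (q : ℕ → ℝ) :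
    IndepFun (fun ω t => removeDisp d R (fun t => B t ω) t)
      (fun ω => ∑ j ∈ R, q j * midDisp d j fun t => B t ω) P := by
  set Q : Ω → ℝ := fun ω => ∑ j ∈ R, q j * midDisp d j fun t => B t ω with hQ
  set Y : ℝ → Ω → ℝ := fun t ω => removeDisp d R (fun t => B t ω) t with hY
  have hD := midDisp_mem_span B d
  have hQs : Q ∈ Submodule.span ℝ (range B) := by
    have : Q = ∑ j ∈ R, q j • fun ω => midDisp d j fun t => B t ω := by ext ω; simp [hQ]
    rw [this]
    exact Submodule.sum_mem _ fun j _ => Submodule.smul_mem _ _ (hD j)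
  have hYs : ∀ t, Y t ∈ Submodule.span ℝ (range B) := fun t => by
    have : Y t = B t - ∑ j ∈ R, (4 / d * tent d j t) • fun ω => midDisp d j fun t => B t ω := by
      ext ω; simp [hY, removeDisp]
    rw [this]
    exact Submodule.sub_mem _ (Submodule.subset_span ⟨t, rfl⟩)
      (Submodule.sum_mem _ fun j _ => Submodule.smul_mem _ _ (hD j))
  have hDm := fun j => hB.measurable_midDisp (d := d) j
  have hQm : Measurable Q := Finset.measurable_fun_sum _ fun j _ => (hDm j).const_mul _
  have hYm : ∀ t, Measurable (Y t) := fun t =>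
    (hB.meas t).sub (Finset.measurable_fun_sum _ fun j _ => (hDm j).const_mul _)
  have hmem := fun j (c : ℝ) => (hB.memLp_midDisp (d := d) j).const_mul c
  have hQ2 : MemLp Q 2 P := memLp_finsetSum _ fun j _ => hmem j (q j)
  -- The path and `Q` are jointly Gaussian, so zero covariance suffices. `removeDisp` subtracts the
  -- orthogonal projection onto the displacements: 4 / d times the variance d / 4 is 1, and the two
  -- covariances cancel.
  have hind := IsGaussianProcess.indepFun_of_covariance_eq_zero (X := Y) (Y := fun _ : Unit => Q)
    (P := P) (isGaussianProcess_of_mem_span hB.gauss (by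
      rintro (t | _)
      · exact hYs t
      · exact hQs)) (fun t => (hYm t).aemeasurable) (fun _ => hQm.aemeasurable) (fun t _ => by
      have hDt : ∀ j ∈ R, cov[B t, fun ω => q j * midDisp d j fun t => B t ω; P]
          = q j * tent d j t := fun j hj => by
        rw [covariance_const_mul_right, covariance_comm, hB.covariance_midDisp_eval hd (hR j hj)]
      have hDD : ∀ i ∈ R, ∀ j ∈ R, cov[fun ω => 4 / d * tent d i t * midDisp d i fun t => B t ω,
          fun ω => q j * midDisp d j fun t => B t ω; P]
          = if i = j then q j * tent d j t else 0 := fun i _ j hj => by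
        rw [covariance_const_mul_left, covariance_const_mul_right,
          hB.covariance_midDisp_midDisp hd (hR j hj)]
        split_ifs with h
        · subst h; field_simp
        · ring
      simp only [hY, removeDisp]
      rw [covariance_fun_sub_left (hB.memLp t)
        (memLp_finsetSum _ fun j _ => hmem j (4 / d * tent d j t)) hQ2,
        covariance_fun_sum_left' (fun j _ => hmem j (4 / d * tent d j t)) hQ2, hQ,
        covariance_fun_sum_right' (fun j _ => hmem j (q j)) (hB.memLp t),
        Finset.sum_congr rfl hDt, sub_eq_zero]
      have : ∀ i ∈ R, cov[fun ω => 4 / d * tent d i t * midDisp d i fun t => B t ω,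
          fun ω => ∑ j ∈ R, q j * midDisp d j fun t => B t ω; P] = q i * tent d i t := by
        intro i hi
        rw [covariance_fun_sum_right' (fun j _ => hmem j (q j)) (hmem i _),
          Finset.sum_congr rfl (hDD i hi)]
        simp [hi]
      exact (Finset.sum_congr rfl this).symm)
  exact hind.comp measurable_id (measurable_pi_apply ())

end Displacement

/-! ### The lower bound -/

lemma measurable_intervalIntegral_mul {Ω : Type*} [MeasurableSpace Ω] {Y : ℝ → Ω → ℝ}
    (hY : ∀ t, Measurable (Y t)) (hYc : ∀ ω, Continuous fun t => Y t ω) {F : ℝ → ℝ}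
    (hF : Continuous F) (a b : ℝ) : Measurable fun ω => ∫ s in a..b, F s * Y s ω := by
  have h1 : StronglyMeasurable fun p : Ω × ℝ => F p.2 * Y p.2 p.1 := by
    refine Measurable.stronglyMeasurable ?_
    exact (hF.measurable.comp measurable_snd).mul
      ((measurable_uncurry_of_continuous_of_measurable hYc hY).comp
        (measurable_snd.prodMk measurable_fst))
  simp only [intervalIntegral]
  exact (h1.integral_prod_right' (ν := volume.restrict (Ioc a b))).measurable.sub
    (h1.integral_prod_right' (ν := volume.restrict (Ioc b a))).measurable

section Core

variable {Ω : Type*} {mΩ : MeasurableSpace Ω} {P : Measure Ω} {T δ d : ℝ} {B : ℝ → Ω → ℝ}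

lemma continuous_removeDisp {R : Finset ℕ} {w : ℝ → ℝ} (hw : Continuous w) :
    Continuous (removeDisp d R w) := by
  unfold removeDisp
  have := fun j => continuous_tent (d := d) (j := j)
  fun_prop

lemma integral_mul_eq_removeDisp_add {F w : ℝ → ℝ} (hF : Continuous F) (hw : Continuous w)
    (R : Finset ℕ) (a b : ℝ) :
    ∫ s in a..b, F s * w s = (∫ s in a..b, F s * removeDisp d R w s)
      + ∑ j ∈ R, (4 / d * ∫ s in a..b, F s * tent d j s) * midDisp d j w := by
  have hc := continuous_removeDisp (d := d) (R := R) hw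
  have ht := fun j => continuous_tent (d := d) (j := j)
  have e : ∀ s, F s * w s = F s * removeDisp d R w s
      + ∑ j ∈ R, F s * tent d j s * (4 / d * midDisp d j w) := by
    intro s
    have h : ∑ j ∈ R, F s * tent d j s * (4 / d * midDisp d j w)
        = F s * ∑ j ∈ R, 4 / d * tent d j s * midDisp d j w := by
      rw [Finset.mul_sum]
      exact Finset.sum_congr rfl fun j _ => by ring
    rw [removeDisp, h]
    ring
  simp_rw [e]
  rw [intervalIntegral.integral_add (Continuous.intervalIntegrable (by fun_prop) _ _)
    (Continuous.intervalIntegrable (by fun_prop) _ _),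
    intervalIntegral.integral_finsetSum fun j _ => Continuous.intervalIntegrable
      (by fun_prop) _ _]
  congr 1
  refine Finset.sum_congr rfl fun j _ => ?_
  rw [intervalIntegral.integral_mul_const]
  ring

/-- The error estimate on the event that the method stops after `k + 1` evaluations which hit
exactly the intervals with index in `S`. -/
lemma AdaptiveMethod.lintegral_error_ge [IsProbabilityMeasure P]
    (hB : IsContinuousBrownian T B P) (hδ : δ ∈ Ioc 0 T) (M : AdaptiveMethod δ T) (hd : 0 < d)
    {n k : ℕ} (hk : k < n) (hLd : (2 * n : ℕ) * d ≤ δ) {F G ψ : ℝ → ℝ} (hF : Continuous F)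
    (hG : Continuous G) (hψ : Continuous ψ) {r : ℝ} (hr : 0 < r)
    (hrF : ∀ t ∈ Icc 0 ((2 * n : ℕ) * d), r ≤ |F t|) (hG0 : ∀ t ≤ (2 * n : ℕ) * d, G t = 0)
    {K : ℝ} (hK0 : 0 ≤ K) (hK : 3 / 4 ≤ K ^ 2 * (n * (r ^ 2 * d ^ 3 / 16))) (γ : ℝ)
    (S : Finset ℕ) :
    ENNReal.ofReal (|γ| * (9 / 196)) * P {ω | (M.StopsAt k (fun t => B t ω)
        ∧ M.touched d (2 * n) k (fun t => B t ω) = S) ∧ K ≤ ψ (- ∫ s in (0 : ℝ)..T, G s * B s ω)}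
      ≤ ∫⁻ ω in {ω | (M.StopsAt k (fun t => B t ω)
        ∧ M.touched d (2 * n) k (fun t => B t ω) = S) ∧ K ≤ ψ (- ∫ s in (0 : ℝ)..T, G s * B s ω)},
        ENNReal.ofReal |γ * Real.cos (ψ (- ∫ s in (0 : ℝ)..T, G s * B s ω)
            * (- ∫ s in (0 : ℝ)..T, F s * B s ω))
          - M.estimate k (M.data (fun t => B t ω) (k + 1)) 3| ∂P := by
  set L := 2 * n with hL
  set E := {ω | (M.StopsAt k (fun t => B t ω) ∧ M.touched d L k (fun t => B t ω) = S)
    ∧ K ≤ ψ (- ∫ s in (0 : ℝ)..T, G s * B s ω)} with hE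
  -- A single point of the event shows that S is a possible hit set, hence has at most k + 1 ≤ n of
  -- the 2n indices.
  rcases E.eq_empty_or_nonempty with hemp | ⟨ω₀, hω₀⟩
  · simp [hemp]
  have hSL : S ⊆ Finset.range L := hω₀.1.2 ▸ M.touched_subset
  have hSc : S.card ≤ k + 1 := hω₀.1.2 ▸ M.card_touched_le hd
  set R := Finset.range L \ S with hR
  have hRc : n ≤ R.card := by
    rw [hR, Finset.card_sdiff_of_subset hSL, Finset.card_range]
    omega
  have hRd' : ∀ j ∈ R, ((j : ℝ) + 1) * d ≤ (L : ℕ) * d := fun j hj => by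
    have : ((j : ℝ) + 1) ≤ L := by
      exact_mod_cast (Finset.mem_range.1 (Finset.mem_sdiff.1 hj).1)
    gcongr
  have hRT : ∀ j ∈ R, ((j : ℝ) + 1) * d ≤ T := fun j hj =>
    (hRd' j hj).trans (hLd.trans hδ.2)
  set Y : ℝ → Ω → ℝ := fun t ω => removeDisp d R (fun t => B t ω) t with hY
  have hYc : ∀ ω, Continuous fun t => Y t ω := fun ω => continuous_removeDisp (hB.cont ω)
  have hYB : ∀ ω t, (∀ j < L, j ∉ S → t ∉ Ioo ((j : ℝ) * d) ((j + 1) * d)) → B t ω = Y t ω :=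
    fun ω t h => (removeDisp_eq_self hd (fun t => B t ω) fun j hj => by
      obtain ⟨h1, h2⟩ := Finset.mem_sdiff.1 hj
      exact h j (Finset.mem_range.1 h1) h2).symm
  have hlarge : ∀ t, (L : ℕ) * d ≤ t → ∀ j < L, t ∉ Ioo ((j : ℝ) * d) ((j + 1) * d) := by
    intro t ht j hj hmem
    have h1 : ((j : ℝ) + 1) * d ≤ L * d := by
      have : ((j : ℝ) + 1) ≤ L := by exact_mod_cast hj
      gcongr
    linarith [hmem.2]
  have hYδ : ∀ ω, ∀ t ∈ Icc δ T, B t ω = Y t ω := fun ω t ht =>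
    hYB ω t fun j hj _ => hlarge t (hLd.trans ht.1) j hj
  have hG1 : ∀ ω, ∫ s in (0 : ℝ)..T, G s * B s ω = ∫ s in (0 : ℝ)..T, G s * Y s ω := fun ω => by
    refine intervalIntegral.integral_congr fun s _ => ?_
    rcases le_total s ((L : ℕ) * d) with hs | hs
    · simp [hG0 s hs]
    · simp only [hYB ω s fun j hj _ => hlarge s hs j hj]
  set q : ℕ → ℝ := fun j => -(4 / d * ∫ s in (0 : ℝ)..T, F s * tent d j s) with hq
  set Q : Ω → ℝ := fun ω => ∑ j ∈ R, q j * midDisp d j fun t => B t ω with hQ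
  have hF1 : ∀ ω, - ∫ s in (0 : ℝ)..T, F s * B s ω
      = (- ∫ s in (0 : ℝ)..T, F s * Y s ω) + Q ω := fun ω => by
    rw [integral_mul_eq_removeDisp_add (d := d) hF (hB.cont ω) R, neg_add]
    simp only [hQ, hq, hY, neg_mul, Finset.sum_neg_distrib]
  have hDm := fun j => hB.measurable_midDisp (d := d) j
  have hYm : ∀ t, Measurable (Y t) := fun t =>
    (hB.meas t).sub (Finset.measurable_fun_sum _ fun j _ => (hDm j).const_mul _)
  have hQm : Measurable Q := Finset.measurable_fun_sum _ fun j _ => (hDm j).const_mul _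
  have hm₀le : MeasurableSpace.comap (fun ω t => Y t ω) inferInstance ≤ mΩ :=
    (measurable_pi_iff.2 hYm).comap_le
  set m₀ : MeasurableSpace Ω := MeasurableSpace.comap (fun ω t => Y t ω) inferInstance with hm₀
  have hYm₀ : ∀ t, Measurable[m₀] (Y t) := fun t =>
    (measurable_pi_apply t).comp (comap_measurable fun ω t => Y t ω)
  -- The modified path differs from the original only inside intervals that were not hit, so the run
  -- of the method and the integral of `G` are unchanged. This makes `E` measurable with respect to
  -- `m₀`.
  have hE' : E = {ω | (M.StopsAt k (fun t => Y t ω) ∧ M.touched d L k (fun t => Y t ω) = S)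
      ∧ K ≤ ψ (- ∫ s in (0 : ℝ)..T, G s * Y s ω)} := by
    ext ω
    simp only [hE, mem_ofPred_eq, hG1 ω]
    rw [M.stopsAt_and_touched_iff (hYδ ω) (hYB ω)]
  have hdata : ∀ ω ∈ E, M.data (fun t => B t ω) (k + 1) = M.data (fun t => Y t ω) (k + 1) := by
    rintro ω ⟨⟨-, hS⟩, -⟩
    refine M.data_congr_of_touched_eq (d := d) (L := L) (k := k) (hYδ ω) ?_ (k + 1) le_rfl
    rw [hS]
    exact hYB ω
  have hIm : ∀ {H : ℝ → ℝ}, Continuous H →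
      Measurable[m₀] fun ω => - ∫ s in (0 : ℝ)..T, H s * Y s ω := fun hH =>
    (measurable_intervalIntegral_mul hYm₀ hYc hH 0 T).neg
  have hEm : MeasurableSet[m₀] E := by
    rw [hE']
    refine ((M.measurableSet_stopsAt hYm₀ hYc k).inter
      (M.measurableSet_touched_eq hYm₀ hYc d L k S)).inter ?_
    exact measurableSet_le measurable_const (hψ.measurable.comp (hIm hG))
  set v : ℝ := ∑ j ∈ R, q j ^ 2 * (d / 4) with hv
  -- A tent has integral d² / 8, so |q j| ≥ (4 / d) r d² / 8 = r d / 2; this is squared and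
  -- multiplied by the displacement variance d / 4.
  have hq2 : ∀ j ∈ R, r ^ 2 * d ^ 3 / 16 ≤ q j ^ 2 * (d / 4) := by
    intro j hj
    have h1 := abs_integral_mul_tent_ge hd hF (hRd' j hj) (hLd.trans hδ.2) hr hrF
    have h2 : r * (d / 2) ≤ |q j| := by
      rw [hq, abs_neg, abs_mul, abs_of_pos (by positivity)]
      calc r * (d / 2) = 4 / d * (r * (d ^ 2 / 8)) := by field_simp; norm_num
        _ ≤ _ := by gcongr
    have h3 := pow_le_pow_left₀ (by positivity) h2 2
    rw [sq_abs] at h3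
    calc r ^ 2 * d ^ 3 / 16 = (r * (d / 2)) ^ 2 * (d / 4) := by ring
      _ ≤ _ := by gcongr
  have hvge : n * (r ^ 2 * d ^ 3 / 16) ≤ v := by
    have h1 := Finset.card_nsmul_le_sum R _ _ hq2
    rw [nsmul_eq_mul] at h1
    refine le_trans ?_ h1
    have : (n : ℝ) ≤ R.card := by exact_mod_cast hRc
    gcongr
  have hv0 : 0 ≤ v := le_trans (by positivity) hvge
  have hind := (IndepFun_iff_Indep _ _ _).1 (hB.indep_removeDisp hd hRT q)
  have hmain := lintegral_abs_cos_sub_ge_of_indep P hm₀le hQm (hB.map_sum_midDisp hd hRT q) hind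
    (c := fun ω => ψ (- ∫ s in (0 : ℝ)..T, G s * Y s ω))
    (m := fun ω => - ∫ s in (0 : ℝ)..T, F s * Y s ω)
    (φ := fun ω => M.estimate k (M.data (fun t => Y t ω) (k + 1)) 3)
    (hψ.measurable.comp (hIm hG)) (hIm hF)
    ((EuclideanSpace.proj (𝕜 := ℝ) (3 : Fin 4)).continuous.measurable.comp
      ((M.estimate_meas k).comp (M.measurable_data hYm₀ hYc (k + 1)))) hEm (fun ω hω => by
      rw [Real.coe_toNNReal _ hv0]
      have h1 : K ≤ ψ (- ∫ s in (0 : ℝ)..T, G s * Y s ω) := by rw [← hG1]; exact hω.2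
      calc 3 / 4 ≤ K ^ 2 * (n * (r ^ 2 * d ^ 3 / 16)) := hK
        _ ≤ _ := by gcongr) γ
  refine hmain.trans (le_of_eq ?_)
  refine setLIntegral_congr_fun (hm₀le _ hEm) fun ω hω => ?_
  simp only [hG1, hF1, hdata ω hω]

end Core

/-! ### Positivity and form of the constants α and β -/

section Setting

variable {T τ₁ τ₂ : ℝ} {f g h : ℝ → ℝ}

lemma IsSetting.deriv_bddBelow (f : ℝ → ℝ) (τ : ℝ) {p : ℕ} :
    BddBelow (range fun t : Icc (0 : ℝ) τ => |deriv f t| ^ p) :=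
  ⟨0, by rintro _ ⟨t, rfl⟩; positivity⟩

lemma IsSetting.alphaConst_pos (hS : IsSetting T τ₁ τ₂ f g h) : 0 < alphaConst τ₁ f := by
  have h0 := hS.f_deriv
  have hτ : (0 : ℝ) ≤ τ₁ / 2 := by linarith [hS.τ₁_pos]
  have : Nonempty (Icc (0 : ℝ) (τ₁ / 2)) := ⟨⟨0, le_rfl, hτ⟩⟩
  have hbdd : BddBelow (range fun t : Icc (0 : ℝ) (τ₁ / 2) => |deriv f t|) := by
    simpa using IsSetting.deriv_bddBelow f (τ₁ / 2) (p := 1)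
  refine lt_of_lt_of_le (pow_pos h0 2) (le_ciInf fun t => ?_)
  exact pow_le_pow_left₀ h0.le (ciInf_le hbdd t) 2

lemma IsSetting.sqrt_alphaConst_le (_hS : IsSetting T τ₁ τ₂ f g h) {t : ℝ}
    (ht : t ∈ Icc 0 (τ₁ / 2)) : √(alphaConst τ₁ f) ≤ |deriv f t| := by
  rw [← Real.sqrt_sq (abs_nonneg (deriv f t))]
  exact Real.sqrt_le_sqrt (ciInf_le (IsSetting.deriv_bddBelow f (τ₁ / 2) (p := 2)) ⟨t, ht⟩)

lemma IsSetting.g_eq_zero_of_le (hS : IsSetting T τ₁ τ₂ f g h) {t : ℝ} (ht : t ≤ τ₁) : g t = 0 := by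
  have h1 : EqOn g 0 (Iio τ₁) := fun x hx => by
    by_contra hne
    exact absurd (hS.g_supp hne).1 (not_le.2 hx)
  have h2 := h1.closure hS.g_smooth.continuous continuous_const
  rw [closure_Iio] at h2
  exact h2 ht

lemma IsSetting.deriv_g_eq_zero (hS : IsSetting T τ₁ τ₂ f g h) {t : ℝ} (ht : t < τ₁) :
    deriv g t = 0 := by
  have : g =ᶠ[𝓝 t] fun _ => 0 := by
    filter_upwards [Iio_mem_nhds ht] with y hy using hS.g_eq_zero_of_le (le_of_lt hy)
  rw [this.deriv_eq]
  simp

lemma IsSetting.betaConst_eq (hS : IsSetting T τ₁ τ₂ f g h) :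
    betaConst τ₁ τ₂ g = ∫ t in (0 : ℝ)..T, g t ^ 2 := by
  have hc : Continuous fun t => g t ^ 2 := hS.g_smooth.continuous.pow 2
  have hi : ∀ a b, IntervalIntegrable (fun t => g t ^ 2) volume a b := fun a b =>
    hc.intervalIntegrable a b
  rw [← intervalIntegral.integral_add_adjacent_intervals (hi 0 τ₁) (hi _ T),
    ← intervalIntegral.integral_add_adjacent_intervals (hi τ₁ τ₂) (hi _ T), betaConst]
  have h1 : ∫ t in (0 : ℝ)..τ₁, g t ^ 2 = 0 := by
    refine (intervalIntegral.integral_congr (g := fun _ => 0) fun t ht => ?_).trans (by simp)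
    rw [uIcc_of_le hS.τ₁_pos.le] at ht
    simp [hS.g_eq_zero_of_le ht.2]
  have h2 : ∫ t in τ₂..T, g t ^ 2 = 0 := by
    refine (intervalIntegral.integral_congr (g := fun _ => 0) fun t ht => ?_).trans (by simp)
    rw [uIcc_of_le hS.τ₂_lt.le] at ht
    simp [eq_zero_of_support_subset_Iic hS.g_smooth.continuous
      (hS.g_supp.trans Icc_subset_Iic_self) ht.1]
  rw [h1, h2, zero_add, add_zero]

lemma IsSetting.betaConst_pos (hS : IsSetting T τ₁ τ₂ f g h) : 0 < betaConst τ₁ τ₂ g := by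
  obtain ⟨x, hx⟩ := Function.ne_iff.1 hS.g_ne
  refine intervalIntegral.integral_pos hS.τ₁_lt (hS.g_smooth.continuous.pow 2).continuousOn
    (fun _ _ => sq_nonneg _) ⟨x, hS.g_supp hx, ?_⟩
  exact pow_pos (abs_pos.2 hx) 2 |>.trans_eq (sq_abs _)

end Setting

/-! ### Comparison of constants and conclusion -/

/-- The constant obtained from the variance of the cosine dominates the constant in the
theorem. -/
lemma exp_neg_pi_sq_div_le : Real.exp (-(Real.pi ^ 2 / 4)) / (4 * Real.pi) ≤ 9 / 196 := by
  have hpi := Real.pi_gt_three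
  have h1 : Real.exp (-(Real.pi ^ 2 / 4)) ≤ 4 / 13 := by
    rw [Real.exp_neg, inv_le_comm₀ (Real.exp_pos _) (by norm_num)]
    nlinarith [Real.add_one_le_exp (Real.pi ^ 2 / 4)]
  rw [div_le_iff₀ (by positivity)]
  nlinarith

/-- With c₀ = exp(-π²/4) / (4π), the left side is |γ| c₀ (q/2 - 1/N). Here q bounds the Gaussian
tail from below and 1/N bounds the probability of late stopping from above; the factor 1/2 is given
away. -/
lemma lower_bound_le {β γ x p q : ℝ} {N : ℝ} (hq : q = Real.exp (-(1 / β) - 1 / β * x ^ 2) /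
    √(2 * Real.pi * β)) (hqp : q ≤ p + 1 / N) (hp : 0 ≤ p) :
    c₁Const β γ * Real.exp (-(1 / β * x ^ 2)) - c₂Const γ / N ≤ |γ| * (9 / 196) * p := by
  set c₀ := Real.exp (-(Real.pi ^ 2 / 4)) / (4 * Real.pi) with hc₀
  have hc₀0 : 0 ≤ c₀ := by positivity
  have hq0 : 0 ≤ q := by rw [hq]; positivity
  have e : c₁Const β γ * Real.exp (-(1 / β * x ^ 2)) - c₂Const γ / N
      = |γ| * c₀ * (q / 2 - 1 / N) := by
    have hexp : Real.exp (-(1 / β) - 1 / β * x ^ 2)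
        = Real.exp (-(1 / β)) * Real.exp (-(1 / β * x ^ 2)) := by
      rw [← Real.exp_add]; ring_nf
    have hexp' : Real.exp (-(Real.pi ^ 2 / 4) - 1 / β)
        = Real.exp (-(Real.pi ^ 2 / 4)) * Real.exp (-(1 / β)) := by
      rw [← Real.exp_add]; ring_nf
    rw [c₁Const, c₂Const, hq, hexp, hexp', hc₀]
    ring
  rw [e]
  calc |γ| * c₀ * (q / 2 - 1 / N) ≤ |γ| * c₀ * p := by gcongr; linarith
    _ ≤ |γ| * (9 / 196) * p := by gcongr; exact exp_neg_pi_sq_div_le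

/-- There are N² free intervals of length D / (2N²), each contributing α d³ / 16, so the variance is
α D³ / (128 N⁴). The number 96 comes from 96 / 128 = 3 / 4. -/
lemma threshold_le {α D : ℝ} (hα : 0 < α) (hD : 0 < D) {N : ℕ} (hN : 1 ≤ N) :
    3 / 4 ≤ ((1 + √(96 / (α * D ^ 3))) * (N : ℝ) ^ 3) ^ 2
      * ((N ^ 2 : ℕ) * (√α ^ 2 * (D / (2 * N ^ 2 : ℕ)) ^ 3 / 16)) := by
  have hN' : (1 : ℝ) ≤ N := by exact_mod_cast hN
  have hN0 : (0 : ℝ) < N := by linarith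
  set s := √(96 / (α * D ^ 3)) with hs
  have hs2 : s ^ 2 = 96 / (α * D ^ 3) := Real.sq_sqrt (by positivity)
  have hs0 : 0 ≤ s := Real.sqrt_nonneg _
  rw [Real.sq_sqrt hα.le]
  have e : ((1 + s) * (N : ℝ) ^ 3) ^ 2 * ((N ^ 2 : ℕ) * (α * (D / (2 * N ^ 2 : ℕ)) ^ 3 / 16))
      = (1 + s) ^ 2 * (α * D ^ 3 / 128) * N ^ 2 := by
    push_cast
    field_simp
    norm_num
  rw [e]
  have h1 : 96 / (α * D ^ 3) ≤ (1 + s) ^ 2 := by rw [← hs2]; gcongr; linarith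
  calc (3 : ℝ) / 4 = 96 / (α * D ^ 3) * (α * D ^ 3 / 128) * 1 := by field_simp; norm_num
    _ ≤ _ := by
      gcongr
      nlinarith

theorem theorem1 {Ω : Type*} {mΩ : MeasurableSpace Ω} (P : Measure Ω) [IsProbabilityMeasure P]
    (T : ℝ) (𝓕 : Filtration ℝ mΩ) (h𝓕 : IsNormalFiltration T 𝓕 P)
    (W : ℝ → Ω → ℝ) (hW : IsBrownianMotionOn T 𝓕 W P)
    (τ₁ τ₂ : ℝ) (f g h : ℝ → ℝ) (hfgh : IsSetting T τ₁ τ₂ f g h)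
    (δ : ℝ) (hδ : δ ∈ Ioc 0 T)
    (ψ : ℝ → ℝ) (hψ_smooth : ContDiff ℝ (⊤ : ℕ∞) ψ) (hψ_pos : ∀ x, 0 < ψ x) (hψ_mono : StrictMono ψ)
    (hψ_lim : Tendsto ψ atTop atTop) (hψ_one : (1 : ℝ) ∈ range ψ)
    (X : ℝ → Ω → E4)
    (hX : IsSDESolution T 𝓕 P W (driftCoeff h ψ) (diffusionCoeff f g) 0 X)
    (N : ℕ) (hN : 1 ≤ N)
    (M : AdaptiveMethod δ T)
    (hM_stops : ∀ᵐ ω ∂P, M.Stops (fun t => W t ω))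
    (hM_cost : M.cost P W ≤ N) :
    ENNReal.ofReal
        (c₁Const (betaConst τ₁ τ₂ g) (gammaConst τ₂ T h) *
            Real.exp (-(1 / betaConst τ₁ τ₂ g *
              Function.invFun ψ
                ((1 + √(96 / (alphaConst τ₁ f * min δ (τ₁ / 2) ^ 3))) * (N : ℝ) ^ 3) ^ 2))
          - c₂Const (gammaConst τ₂ T h) / N)
      ≤ ∫⁻ ω, ‖X T ω - M.output (fun t => W t ω)‖ₑ ∂P := by
  classical
  have hτ₁ := hfgh.τ₁_pos
  have hT : 0 ≤ T := hδ.1.le.trans hδ.2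
  have hTm : T ∈ Icc 0 T := ⟨hT, le_rfl⟩
  have hα := hfgh.alphaConst_pos
  have hβ := hfgh.betaConst_pos
  have hf1 : ContDiff ℝ 1 f := hfgh.f_smooth.of_le (by exact_mod_cast le_top)
  have hg1 : ContDiff ℝ 1 g := hfgh.g_smooth.of_le (by exact_mod_cast le_top)
  have hF : Continuous (deriv f) := hf1.continuous_deriv le_rfl
  have hG : Continuous (deriv g) := hg1.continuous_deriv le_rfl
  have hψ : Continuous ψ := hψ_smooth.continuous
  obtain ⟨B, hB, hBW⟩ := hW.exists_isContinuousBrownian hT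
  set α := alphaConst τ₁ f
  set β := betaConst τ₁ τ₂ g
  set γ := gammaConst τ₂ T h
  set D := min δ (τ₁ / 2) with hD
  have hDpos : 0 < D := lt_min hδ.1 (by linarith)
  set K : ℝ := (1 + √(96 / (α * D ^ 3))) * (N : ℝ) ^ 3 with hK
  have hN' : (1 : ℝ) ≤ N := by exact_mod_cast hN
  have hK1 : 1 ≤ K := by
    have h1 : (1 : ℝ) ≤ (N : ℝ) ^ 3 := one_le_pow₀ hN'
    have h2 := Real.sqrt_nonneg (96 / (α * D ^ 3))
    nlinarith
  set x := Function.invFun ψ K with hx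
  -- `Function.invFun` is a true inverse at K because 1 ≤ K, 1 is a value of ψ, and ψ is continuous
  -- and unbounded above.
  have hψx : ψ x = K := by
    obtain ⟨y, hy⟩ := hψ_one
    obtain ⟨z, hz⟩ := (hψ_lim.eventually_ge_atTop K).exists
    exact Function.invFun_eq (mem_range_of_exists_le_of_exists_ge hψ ⟨y, hy.trans_le hK1⟩ ⟨z, hz⟩)
  -- With mean cost at most N, Markov's inequality at level N² leaves probability 1 / N for late
  -- stopping.
  set n := N ^ 2 with hn
  have hn0 : 0 < n := by positivity
  set d := D / (2 * N ^ 2 : ℕ) with hd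
  have hdpos : 0 < d := by positivity
  have hLd : (2 * n : ℕ) * d = D := by
    rw [hd, hn]
    field_simp
  set I₁ : Ω → ℝ := fun ω => - ∫ s in (0 : ℝ)..T, deriv f s * B s ω with hI₁
  set I₂ : Ω → ℝ := fun ω => - ∫ s in (0 : ℝ)..T, deriv g s * B s ω with hI₂
  have hI₂m : Measurable I₂ := (measurable_intervalIntegral_mul hB.meas hB.cont hG 0 T).neg
  have hIW : ∀ᵐ ω ∂P, (∀ F : ℝ → ℝ, ∫ s in (0 : ℝ)..T, F s * W s ω
      = ∫ s in (0 : ℝ)..T, F s * B s ω) := by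
    filter_upwards [hBW] with ω hω F
    refine intervalIntegral.integral_congr fun s hs => ?_
    rw [uIcc_of_le hT] at hs
    simp only [hω s hs]
  have hdataW : ∀ᵐ ω ∂P, ∀ i, M.data (fun t => W t ω) i = M.data (fun t => B t ω) i := by
    filter_upwards [hBW] with ω hω i
    exact M.data_congr_of_eqOn hδ (fun t ht => (hω t ht).symm) i
  -- the events on which the estimate is applied
  set E : ℕ × Finset ℕ → Set Ω := fun e => {ω | (M.StopsAt e.1 (fun t => B t ω)
    ∧ M.touched d (2 * n) e.1 (fun t => B t ω) = e.2) ∧ K ≤ ψ (I₂ ω)} with hE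
  set J : Finset (ℕ × Finset ℕ) := Finset.range n ×ˢ (Finset.range (2 * n)).powerset with hJ
  have hEm : ∀ e, MeasurableSet (E e) := fun e =>
    ((M.measurableSet_stopsAt hB.meas hB.cont e.1).inter
      (M.measurableSet_touched_eq hB.meas hB.cont d (2 * n) e.1 e.2)).inter
      (measurableSet_le measurable_const (hψ.measurable.comp hI₂m))
  have hEd : PairwiseDisjoint (J : Set (ℕ × Finset ℕ)) E := by
    intro e _ e' _ hne
    refine Set.disjoint_left.2 fun ω h1 h2 => hne ?_
    have hk := h1.1.1.unique h2.1.1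
    refine Prod.ext hk ?_
    rw [← h1.1.2, ← h2.1.2, hk]
  set A : Set Ω := ⋃ k ∈ Finset.range n, {ω | M.StopsAt k fun t => B t ω} with hA
  have hAm : MeasurableSet A := Finset.measurableSet_biUnion _ fun k _ =>
    M.measurableSet_stopsAt hB.meas hB.cont k
  have hEU : {ω | x ≤ I₂ ω} ∩ A ⊆ ⋃ e ∈ J, E e := by
    rintro ω ⟨hω, hωA⟩
    simp only [hA, mem_iUnion] at hωA
    obtain ⟨k, hk, hs⟩ := hωA
    simp only [mem_iUnion]
    refine ⟨(k, M.touched d (2 * n) k fun t => B t ω), ?_, ⟨hs, rfl⟩, ?_⟩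
    · exact Finset.mem_product.2 ⟨hk, Finset.mem_powerset.2 M.touched_subset⟩
    · rw [← hψx]
      exact hψ_mono.monotone hω
  -- the error
  have herr : ENNReal.ofReal (|γ| * (9 / 196)) * P (⋃ e ∈ J, E e)
      ≤ ∫⁻ ω, ‖X T ω - M.output (fun t => W t ω)‖ₑ ∂P := by
    calc ENNReal.ofReal (|γ| * (9 / 196)) * P (⋃ e ∈ J, E e)
        = ∑ e ∈ J, ENNReal.ofReal (|γ| * (9 / 196)) * P (E e) := by
          rw [measure_biUnion_finset hEd fun e _ => hEm e, Finset.mul_sum]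
      _ ≤ ∑ e ∈ J, ∫⁻ ω in E e, ENNReal.ofReal |γ * Real.cos (ψ (I₂ ω) * I₁ ω)
            - M.estimate e.1 (M.data (fun t => B t ω) (e.1 + 1)) 3| ∂P := by
          refine Finset.sum_le_sum fun e he => ?_
          refine M.lintegral_error_ge hB hδ hdpos (Finset.mem_range.1 (Finset.mem_product.1 he).1)
            (hLd.trans_le (min_le_left _ _)) hF hG hψ (r := √α) (Real.sqrt_pos.2 hα)
            (fun t ht => hfgh.sqrt_alphaConst_le ⟨ht.1, ht.2.trans ?_⟩) (fun t ht => ?_)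
            (zero_le_one.trans hK1) (threshold_le hα hDpos hN) γ e.2
          · exact hLd.trans_le (min_le_right _ _)
          · refine hfgh.deriv_g_eq_zero ((ht.trans (hLd.trans_le (min_le_right _ _))).trans_lt ?_)
            linarith
      _ ≤ ∑ e ∈ J, ∫⁻ ω in E e, ‖X T ω - M.output (fun t => W t ω)‖ₑ ∂P := by
          refine Finset.sum_le_sum fun e _ => ?_
          refine lintegral_mono_ae ?_
          filter_upwards [ae_restrict_mem (hEm e), ae_restrict_of_ae hIW,
            ae_restrict_of_ae hdataW, ae_restrict_of_ae (hX.ae_final hW hfgh hψ)]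
            with ω hω hI hdat hfin
          have hs : M.StopsAt e.1 fun t => W t ω :=
            (M.stopsAt_congr fun i _ => hdat i).2 hω.1.1
          rw [hI, hI] at hfin
          rw [hs.output_eq, hdat, ← ofReal_norm]
          refine ENNReal.ofReal_le_ofReal ?_
          -- Only the error in the last coordinate is kept.
          have := PiLp.norm_apply_le
            (X T ω - M.estimate e.1 (M.data (fun t => B t ω) (e.1 + 1))) 3
          rw [PiLp.sub_apply, hfin, Real.norm_eq_abs] at this
          exact this
      _ = ∫⁻ ω in ⋃ e ∈ J, E e, ‖X T ω - M.output (fun t => W t ω)‖ₑ ∂P :=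
          (lintegral_biUnion_finset hEd (fun e _ => hEm e) _).symm
      _ ≤ _ := setLIntegral_le_lintegral _ _
  -- the probability of stopping late
  have hlate : P Aᶜ ≤ ENNReal.ofReal (1 / N) := by
    have h1 : (n : ℝ≥0∞) * P Aᶜ ≤ N := by
      refine le_trans ?_ hM_cost
      rw [← lintegral_indicator_const hAm.compl]
      refine lintegral_mono_ae ?_
      filter_upwards [hdataW] with ω hdat
      by_cases hω : ω ∈ A
      · simp [hω]
      · rw [indicator_of_mem (show ω ∈ Aᶜ from hω)]
        -- Off `A` the method has not stopped within n evaluations, so its cost is at least n,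
        -- infinite cost included.
        have := M.le_numEval (w := fun t => W t ω) (n := n) fun k hk hs => hω (by
          simp only [hA, mem_iUnion]
          exact ⟨k, Finset.mem_range.2 hk, (M.stopsAt_congr fun i _ => hdat i).1 hs⟩)
        exact_mod_cast ENat.toENNReal_le.2 this
    have hN0 : (N : ℝ≥0∞) ≠ 0 := by positivity
    have h2 : (N : ℝ≥0∞) * P Aᶜ ≤ 1 := by
      rw [hn] at h1
      push_cast at h1
      rw [sq, mul_assoc] at h1
      calc (N : ℝ≥0∞) * P Aᶜ = (N : ℝ≥0∞)⁻¹ * (N * (N * P Aᶜ)) := by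
            rw [← mul_assoc, ENNReal.inv_mul_cancel hN0 (by simp), one_mul]
        _ ≤ (N : ℝ≥0∞)⁻¹ * N := by gcongr
        _ = 1 := ENNReal.inv_mul_cancel hN0 (by simp)
    rw [one_div, ENNReal.ofReal_inv_of_pos (by linarith), ENNReal.ofReal_natCast]
    rwa [ENNReal.le_inv_iff_mul_le, mul_comm]
  -- the probability of a large second component
  have hlarge : ENNReal.ofReal (Real.exp (-(1 / β) - 1 / β * x ^ 2) / √(2 * Real.pi * β))
      ≤ P {ω | x ≤ I₂ ω} := by
    have hlaw : P.map I₂ = gaussianReal 0 β.toNNReal := by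
      rw [show β = _ from hfgh.betaConst_eq, ← hW.hasLaw_integral_deriv_mul hTm hg1
        (eq_zero_of_support_subset_Iic hg1.continuous (hfgh.g_supp.trans Icc_subset_Iic_self)
          hfgh.τ₂_lt.le)]
      refine Measure.map_congr ?_
      filter_upwards [hIW] with ω hω
      rw [hω]
    have h1 := gaussianReal_Ici_ge β.toNNReal (Real.toNNReal_pos.2 hβ).ne' x
    rw [← hlaw, Measure.map_apply hI₂m measurableSet_Ici, Real.coe_toNNReal _ hβ.le] at h1
    exact h1
  refine le_trans ?_ herr
  refine le_trans ?_ (mul_le_mul_right (measure_mono hEU) _)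
  set p := P.real ({ω | x ≤ I₂ ω} ∩ A) with hp
  have hpP : P ({ω | x ≤ I₂ ω} ∩ A) = ENNReal.ofReal p := (ofReal_measureReal).symm
  rw [hpP, ← ENNReal.ofReal_mul (by positivity)]
  refine ENNReal.ofReal_le_ofReal (lower_bound_le rfl ?_ measureReal_nonneg)
  rw [← ENNReal.ofReal_le_ofReal_iff (by positivity),
    ENNReal.ofReal_add measureReal_nonneg (by positivity)]
  refine hlarge.trans ?_
  rw [← hpP]
  refine le_trans ?_ (add_le_add_right hlate _)
  refine (measure_mono ?_).trans (measure_union_le _ _)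
  intro ω hω
  by_cases hωA : ω ∈ A
  · exact Or.inl ⟨hω, hωA⟩
  · exact Or.inr hωA
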